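/- **Setting.** The paper is a rectangle $R=[a_0,b_0]\times[a_1,b_1]\subset\mathbb R^2$ with $a_i<b_i$, marked with finitely many nondegenerate line segments in $R$ (the *cuts*); $K$ denotes their union. An *orthogonal folding* of $R$ is a flat folded state of $R$ with finitely many creases, each horizontal or vertical. That is, it is a continuous map $f:R\to\mathbb R^2$ that is locally isometric away from finitely many horizontal and vertical lines (the *creased points* are those near which $f$ is not isometric), and that admits a stacking order of the layers in which no layer crosses another. The folding *solves* the instance if there is a straight line $\ell$ with $\{p\in R: f(p)\in\ell\}=K$. The instance is *solvable* if some orthogonal folding solves it. A crease pattern consisting of vertical lines $x=c$ $(c\in C_0)$ and horizontal lines $y=c$ $(c\in C_1)$, all the way across the paper, is a *solution* if some orthogonal folding whose set of creased points is exactly the union of these lines within $R$ solves the instance. **Stripes and the canonical crease pattern.** A point $p\in K$ is a *vertex* if $K$ does not coincide, in any neighbourhood of $p$, with a straight line through $p$ (so vertices are the ends, bends and crossings of cuts). A position $c\in[a_0,b_0]$ is *allowed* for a vertical crease if every point of $K$ on the line $x=c$ is a vertex; in particular $c$ is allowed if that line misses $K$. A *vertical stripe* is a maximal closed interval $[s,t]$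 of allowed positions, where $s=t$ is permitted (zero width), such that $a_0<s$ and $t<b_0$. (A maximal interval that contains an edge of the paper is regarded as part of the adjacent band and is not a stripe.) Horizontal stripes are defined in the same way with the coordinates exchanged. The *canonical crease pattern* has one vertical crease at the centre $(s+t)/2$ of each vertical stripe and one horizontal crease at the centre of each horizontal stripe, zero-width stripes included. **Theorem.** Let $\alpha\neq 0$ be a real number, and suppose that every cut has slope $\alpha$ or $-\alpha$. Then the canonical crease pattern consists of finitely many creases, and if the instance is solvable, the canonical crease pattern is a solution. Consequently, the instance is solvable if and only if the canonical crease pattern is a solution. -/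

import Mathlib

namespace OrthoFoldCut

/-- The Euclidean plane; coordinate `0` is horizontal and coordinate `1` is vertical. -/
abbrev Plane := EuclideanSpace ℝ (Fin 2)

/-! ### Flat foldings of a piece of paper `R` -/

/-- Near `p` the map `f` moves the paper `R` rigidly. -/
def IsUncreasedAt (R : Set Plane) (f : Plane → Plane) (p : Plane) : Prop :=
  ∃ ε > 0, ∀ q ∈ R ∩ Metric.ball p ε, ∀ r ∈ R ∩ Metric.ball p ε, dist (f q) (f r) = dist q r

/-- The points of the paper that do not lie on a crease. -/
def uncreased (R : Set Plane) (f : Plane → Plane) : Set Plane :=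
  {p | p ∈ R ∧ IsUncreasedAt R f p}

/-- The points of the paper that lie on a crease. -/
def creased (R : Set Plane) (f : Plane → Plane) : Set Plane :=
  {p | p ∈ R ∧ ¬ IsUncreasedAt R f p}

/-- `c` is an interior point of a single horizontal or vertical crease: near `c` the creases form
the line through `c` perpendicular to one of the coordinate axes. -/
def IsSimpleCreasePoint (R : Set Plane) (f : Plane → Plane) (c : Plane) : Prop :=
  c ∈ interior R ∧
    ∃ i : Fin 2, ∃ ε > 0, ∀ p ∈ Metric.ball c ε, p ∈ creased R f ↔ p i = c i

/-- `below` is a valid stacking order of the layers of the folded paper. It compares uncreased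
points of the paper that are folded to the same place, and no layer passes through another one. -/
structure IsLayerOrder (R : Set Plane) (f : Plane → Plane) (below : Plane → Plane → Prop) :
    Prop where
  irrefl : ∀ p ∈ uncreased R f, ¬ below p p
  trans : ∀ p ∈ uncreased R f, ∀ q ∈ uncreased R f, ∀ r ∈ uncreased R f,
    f p = f q → f q = f r → below p q → below q r → below p r
  total : ∀ p ∈ uncreased R f, ∀ q ∈ uncreased R f, f p = f q → p ≠ q → below p q ∨ below q p
  /-- The order of two layers does not change as one moves along them. -/
  consistent : ∀ p ∈ uncreased R f, ∀ q ∈ uncreased R f, f p = f q → below p q →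
    ∃ ε > 0, ∀ p' ∈ uncreased R f ∩ Metric.ball p ε, ∀ q' ∈ uncreased R f ∩ Metric.ball q ε,
      f p' = f q' → below p' q'
  /-- An unfolded layer that continues across a crease does not lie between the two layers
  joined by that crease. -/
  layer_crease : ∀ c t, IsSimpleCreasePoint R f c → t ∈ uncreased R f → t ∈ interior R →
    f c = f t →
    ∃ ε > 0, ∀ p ∈ uncreased R f ∩ Metric.ball c ε, ∀ p' ∈ uncreased R f ∩ Metric.ball c ε,
      ∀ u ∈ uncreased R f ∩ Metric.ball t ε, f p = f u → f p' = f u →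
        ¬ (below p u ∧ below u p')
  /-- The two layers joined by a crease and the two layers joined by another crease at the same
  place do not interleave. -/
  crease_crease : ∀ c d, IsSimpleCreasePoint R f c → IsSimpleCreasePoint R f d → f c = f d →
    ∃ ε > 0, ∀ p ∈ uncreased R f ∩ Metric.ball c ε, ∀ p' ∈ uncreased R f ∩ Metric.ball c ε,
      ∀ q ∈ uncreased R f ∩ Metric.ball d ε, ∀ q' ∈ uncreased R f ∩ Metric.ball d ε,
        f p = f q → f q = f p' → f p' = f q' →
          ¬ (below p q ∧ below q p' ∧ below p' q')

/-- `f` is (the geometry of) a flat folded state of the paper `R` using finitely many creases, all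
of them horizontal or vertical. The creases are not assumed to reach across the paper. -/
def IsOrthogonalFolding (R : Set Plane) (f : Plane → Plane) : Prop :=
  ContinuousOn f R ∧
    (∃ X : Fin 2 → Finset ℝ, ∀ p ∈ creased R f, ∃ i, p i ∈ X i) ∧
    ∃ below : Plane → Plane → Prop, IsLayerOrder R f below

/-! ### Orthogonal fold and cut -/

/-- A rectangular piece of paper `[lo 0, hi 0] × [lo 1, hi 1]`, marked with finitely many
(nondegenerate) line segments, the cuts, each given by its two endpoints. -/
structure FoldCutInstance where
  lo : Fin 2 → ℝ
  hi : Fin 2 → ℝ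
  lo_lt_hi : ∀ i, lo i < hi i
  cuts : Finset (Plane × Plane)
  cuts_ne : ∀ s ∈ cuts, s.1 ≠ s.2
  cuts_subset : ∀ s ∈ cuts, ∀ p ∈ segment ℝ s.1 s.2, ∀ i, lo i ≤ p i ∧ p i ≤ hi i

/-- The segment with endpoints `s.1`, `s.2` has the finite slope `m`. -/
def HasSlope (s : Plane × Plane) (m : ℝ) : Prop :=
  s.1 0 ≠ s.2 0 ∧ s.2 1 - s.1 1 = m * (s.2 0 - s.1 0)

namespace FoldCutInstance

/-- The rectangle of paper. -/
def paper (P : FoldCutInstance) : Set Plane :=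
  {p | ∀ i, P.lo i ≤ p i ∧ p i ≤ P.hi i}

/-- The union of all cuts. -/
def cutSet (P : FoldCutInstance) : Set Plane :=
  {p | ∃ s ∈ P.cuts, p ∈ segment ℝ s.1 s.2}

/-- The folding `f` solves the instance: for some line in the folded state, the part of the paper
that lies on this line is exactly the union of the cuts. -/
def AlignsCuts (P : FoldCutInstance) (f : Plane → Plane) : Prop :=
  ∃ a b : Plane, a ≠ b ∧ ∀ p ∈ P.paper, f p ∈ line[ℝ, a, b] ↔ p ∈ P.cutSet

/-- The instance can be solved by some orthogonal folding. -/
def Solvable (P : FoldCutInstance) : Prop :=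
  ∃ f : Plane → Plane, IsOrthogonalFolding P.paper f ∧ P.AlignsCuts f

/-- The crease pattern consisting of the vertical lines at the positions in `C 0` and the
horizontal lines at the positions in `C 1`, all the way across the paper, is a solution: folding
exactly these creases solves the instance. -/
def IsSolution (P : FoldCutInstance) (C : Fin 2 → Set ℝ) : Prop :=
  ∃ f : Plane → Plane, IsOrthogonalFolding P.paper f ∧
    creased P.paper f = {p | p ∈ P.paper ∧ ∃ i, p i ∈ C i} ∧ P.AlignsCuts f

/-- `p` is a vertex of the cut graph: it lies on a cut, but near `p` the union of the cuts is not
just a straight line through `p`. (Thus ends, bends and crossings of cuts are vertices, while a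
point at which a straight cut is merely written as two cuts is not.) -/
def IsVertex (P : FoldCutInstance) (p : Plane) : Prop :=
  p ∈ P.cutSet ∧
    ¬ ∃ d : Plane, d ≠ 0 ∧ ∃ ε > 0, ∀ q ∈ Metric.ball p ε,
      q ∈ P.cutSet ↔ ∃ t : ℝ, q = p + t • d

/-- Positions `x` at which a vertical crease is allowed (`i = 0`), or positions `y` at which a
horizontal crease is allowed (`i = 1`): the line there meets the cuts only in vertices. -/
def allowed (P : FoldCutInstance) (i : Fin 2) : Set ℝ :=
  {c | c ∈ Set.Icc (P.lo i) (P.hi i) ∧ ∀ p ∈ P.cutSet, p i = c → P.IsVertex p}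

/-- `[s, t]` is a vertical (`i = 0`) or horizontal (`i = 1`) stripe: a maximal closed interval,
possibly a single point, of allowed positions. An interval containing an edge of the paper counts
as part of the adjacent band, hence is not a stripe. -/
def IsStripe (P : FoldCutInstance) (i : Fin 2) (s t : ℝ) : Prop :=
  P.lo i < s ∧ s ≤ t ∧ t < P.hi i ∧ Set.Icc s t ⊆ P.allowed i ∧
    ∀ s' t', s' ≤ s → t ≤ t' → Set.Icc s' t' ⊆ P.allowed i → s' = s ∧ t' = t

/-- The canonical crease pattern: one crease at the centre of each stripe. -/
def canonicalCreases (P : FoldCutInstance) (i : Fin 2) : Set ℝ :=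
  {c | ∃ s t, P.IsStripe i s t ∧ c = (s + t) / 2}

end FoldCutInstance

end OrthoFoldCut

/-! Let `n` be a unit normal of the line that receives the cuts. Off finitely many horizontal and
vertical lines, `⟪n, f p⟫` is locally affine with a gradient of length 1. Its slope in `y` can
therefore change neither within a strip between two vertical lines nor, by continuity, across such a
line (`rectangle_rule`). Hence `⟪n, f p⟫ = H 0 (p 0) + H 1 (p 1)`, where each `H i` is piecewise
linear with slopes `± A i` and `A 0 ^ 2 + A 1 ^ 2 = 1`. Partial creases thus disappear from the
problem: the cut set is `{F 0 x = F 1 y}` for two one-dimensional fold functions. Along any cut `A 0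
= A 1 * |α|`, so both scales are positive.

Now fix one coordinate, with function `F`, and let `[m, M]` be the range of the other function. A
point of the cut set fails to be a vertex exactly when both of its coordinates are interior to the
paper and not creases. So the forbidden positions form the open set `N` of interior non-crease
positions where `F` lies in `(m, M)` (`allowed_eq`). On a gap of `closure N`, `F` stays at or above
`M`, or at or below `m`. There it can be replaced by `M + A * dist(x, N)` or `m - A * dist(x, N)`
without creating cuts. The distance has its only bend at the centre of a gap bounded on both sides
by `N`, and none in a gap that reaches the edge of the paper. The creases inside `closure N` are
exactly the zero-width stripes. So the new function is folded exactly at the canonical creases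
(`isFold_recentre`) and gives the same cut set (`exists_isFold_canonicalCreases`). This is done in
one coordinate and then in the other.

Conversely, any two fold functions of unit slope give a flat folding of the rectangle: pleat in `x`,
then pleat the result in `y`. The stacking order is explicit (`isLayerOrder_productBelow`), and
after rescaling the set `{G 0 x = G 1 y}` lies on a line (`isSolution_of_isFold`). -/

namespace OrthoFoldCut

open Set Filter Topology

/-! ### Fold functions of one variable -/

/-- Near `x`, the function `g` on `[a, b]` is affine with slope `A` or `-A`. -/
def StraightAt (a b A : ℝ) (g : ℝ → ℝ) (x : ℝ) : Prop :=
  ∃ κ, |κ| = A ∧ ∃ ε > 0, ∀ y ∈ Icc a b, |y - x| < ε → g y = g x + κ * (y - x)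

/-- Near `x`, the function `g` on `[a, b]` is folded at `x`, with slopes `A` and `-A`. -/
def BentAt (a b A : ℝ) (g : ℝ → ℝ) (x : ℝ) : Prop :=
  ∃ κ, |κ| = A ∧ ∃ ε > 0, ∀ y ∈ Icc a b, |y - x| < ε → g y = g x + κ * |y - x|

/-- `g` is a one-dimensional folding of `[a, b]`, scaled by `A`, with creases exactly at `C`. -/
structure IsFold (a b A : ℝ) (C : Set ℝ) (g : ℝ → ℝ) : Prop where
  subset : C ⊆ Ioo a b
  straight : ∀ x ∈ Icc a b, x ∉ C → StraightAt a b A g x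
  bent : ∀ x ∈ C, BentAt a b A g x

theorem eq_of_hasDerivAt_zero_off_finite {k : ℝ → ℝ} {a b : ℝ} {X : Set ℝ} (hX : X.Finite)
    (hk : ContinuousOn k (Icc a b)) (hd : ∀ x ∈ Ioo a b, x ∉ X → HasDerivAt k 0 x)
    {x y : ℝ} (hx : x ∈ Icc a b) (hy : y ∈ Icc a b) : k x = k y := by
  wlog hxy : x ≤ y generalizing x y
  · exact (this hy hx (le_of_not_ge hxy)).symm
  have := MeasureTheory.integral_eq_of_hasDerivAt_off_countable_of_le k (fun _ => 0) hxy
    hX.countable (hk.mono (Icc_subset_Icc hx.1 hy.2))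
    (fun z hz => hd z ⟨hx.1.trans_lt hz.1.1, hz.1.2.trans_le hy.2⟩ hz.2) (by simp)
  simp at this
  linarith

/-- The derivative is locally constant, hence constant on the connected open interval; continuity
carries the affine formula to the closed one. -/
theorem affine_of_locally_affine {k : ℝ → ℝ} {A u v : ℝ} (huv : u < v)
    (hk : ContinuousOn k (Icc u v))
    (hl : ∀ x ∈ Ioo u v, ∃ κ, |κ| = A ∧ ∃ ε > 0, ∀ y, |y - x| < ε → k y = k x + κ * (y - x)) :
    ∃ κ, |κ| = A ∧ ∀ y ∈ Icc u v, ∀ z ∈ Icc u v, k y - k z = κ * (y - z) := by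
  have key : ∀ x ∈ Ioo u v, ∃ κ, |κ| = A ∧ ∀ᶠ y in 𝓝 x, HasDerivAt k κ y := by
    intro x hx
    obtain ⟨κ, hκ, ε, hε, h⟩ := hl x hx
    refine ⟨κ, hκ, ?_⟩
    have h1 : ∀ᶠ y in 𝓝 x, k y = k x + κ * (y - x) := by
      filter_upwards [Metric.ball_mem_nhds x hε] with y hy
      exact h y hy
    filter_upwards [h1.eventually_nhds] with y hy
    have h2 : HasDerivAt (fun y => k x + κ * (y - x)) κ y := by
      simpa using (((hasDerivAt_id y).sub_const x).const_mul κ).const_add (k x)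
    exact h2.congr_of_eventuallyEq hy
  have hd0 : ∀ x ∈ Ioo u v, HasDerivAt (deriv k) 0 x := by
    intro x hx
    obtain ⟨κ, -, h⟩ := key x hx
    exact (hasDerivAt_const x κ).congr_of_eventuallyEq (h.mono fun y hy => hy.deriv)
  have hm : (u + v) / 2 ∈ Ioo u v := ⟨by linarith, by linarith⟩
  obtain ⟨κ, hκ, h⟩ := key _ hm
  have hconst : ∀ x ∈ Ioo u v, deriv k x = κ := by
    intro x hx
    rw [← h.self_of_nhds.deriv]
    exact isOpen_Ioo.is_const_of_deriv_eq_zero isPreconnected_Ioo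
      (fun z hz => (hd0 z hz).differentiableAt.differentiableWithinAt)
      (fun z hz => (hd0 z hz).deriv) hx hm
  refine ⟨κ, hκ, fun y hy z hz => ?_⟩
  have := eq_of_hasDerivAt_zero_off_finite (k := fun x => k x - κ * x) finite_empty
    (hk.sub (by fun_prop)) (fun x hx _ => by
      obtain ⟨κ', -, h'⟩ := key x hx
      have h1 := h'.self_of_nhds
      have h2 : κ' = κ := by rw [← hconst x hx, h1.deriv]
      subst h2
      have h3 := h1.sub ((hasDerivAt_id x).const_mul κ')
      rw [mul_one, sub_self] at h3
      exact h3) hy hz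
  linarith

theorem exists_gap {X : Set ℝ} (hX : X.Finite) (x : ℝ) :
    ∃ δ > 0, ∀ y ∈ X, |y - x| < δ → y = x := by
  have h : (X \ {x})ᶜ ∈ 𝓝 x := (hX.subset sdiff_subset).isClosed.isOpen_compl.mem_nhds (by simp)
  obtain ⟨δ, hδ, hb⟩ := Metric.mem_nhds_iff.1 h
  refine ⟨δ, hδ, fun y hy hyx => ?_⟩
  by_contra hne
  exact hb (show y ∈ Metric.ball x δ from hyx) ⟨hy, hne⟩

/-- Next to each point there is a slope on the left and one on the right, both of absolute value
`A`. They agree (straight) or are opposite (bent). At an end of the interval only one side exists,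
so no crease arises there. -/
theorem exists_isFold {k : ℝ → ℝ} {A a b : ℝ} {X : Set ℝ} (hab : a < b) (hX : X.Finite)
    (hk : ContinuousOn k (Icc a b))
    (hl : ∀ x ∈ Ioo a b, x ∉ X →
      ∃ κ, |κ| = A ∧ ∃ ε > 0, ∀ y, |y - x| < ε → k y = k x + κ * (y - x)) :
    ∃ C, C.Finite ∧ IsFold a b A C k := by
  have right : ∀ x ∈ Ico a b, ∃ κ, |κ| = A ∧ ∃ ε > 0, ∀ y ∈ Icc a b, x ≤ y → |y - x| < ε →
      k y = k x + κ * (y - x) := by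
    intro x hx
    obtain ⟨δ, hδ, hg⟩ := exists_gap hX x
    have hlt : x < min (x + δ) b := lt_min (by linarith) hx.2
    obtain ⟨κ, hκ, h⟩ := affine_of_locally_affine (A := A) hlt
      (hk.mono (Icc_subset_Icc hx.1 (min_le_right _ _))) (fun y hy => by
        have h1 := hy.2.trans_le (min_le_left _ _)
        refine hl y ⟨hx.1.trans_lt hy.1, hy.2.trans_le (min_le_right _ _)⟩ fun hyX => ?_
        have := hg y hyX (by rw [abs_lt]; constructor <;> linarith [hy.1])
        linarith [hy.1])
    refine ⟨κ, hκ, δ, hδ, fun y hy hxy hyd => ?_⟩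
    have := h y ⟨hxy, le_min (by linarith [(abs_lt.1 hyd).2]) hy.2⟩ x ⟨le_rfl, hlt.le⟩
    linarith
  have left : ∀ x ∈ Ioc a b, ∃ κ, |κ| = A ∧ ∃ ε > 0, ∀ y ∈ Icc a b, y ≤ x → |y - x| < ε →
      k y = k x + κ * (y - x) := by
    intro x hx
    obtain ⟨δ, hδ, hg⟩ := exists_gap hX x
    have hlt : max (x - δ) a < x := max_lt (by linarith) hx.1
    obtain ⟨κ, hκ, h⟩ := affine_of_locally_affine (A := A) hlt
      (hk.mono (Icc_subset_Icc (le_max_right _ _) hx.2)) (fun y hy => by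
        have h1 := (le_max_left _ _).trans_lt hy.1
        refine hl y ⟨(le_max_right _ _).trans_lt hy.1, hy.2.trans_le hx.2⟩ fun hyX => ?_
        have := hg y hyX (by rw [abs_lt]; constructor <;> linarith [hy.2])
        linarith [hy.2])
    refine ⟨κ, hκ, δ, hδ, fun y hy hxy hyd => ?_⟩
    have := h y ⟨max_le (by linarith [(abs_lt.1 hyd).1]) hy.1, hxy⟩ x ⟨hlt.le, le_rfl⟩
    linarith
  have hint : ∀ x ∈ Ioo a b, x ∉ X → StraightAt a b A k x := by
    intro x hx hxX
    obtain ⟨κ, hκ, ε, hε, h⟩ := hl x hx hxX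
    exact ⟨κ, hκ, ε, hε, fun y _ hy => h y hy⟩
  refine ⟨{x ∈ Ioo a b | ¬ StraightAt a b A k x}, hX.subset fun x hx => ?_, fun x hx => hx.1,
    fun x hx hxC => ?_, fun x hx => ?_⟩
  · by_contra hxX
    exact hx.2 (hint x hx.1 hxX)
  · by_cases hx' : x ∈ Ioo a b
    · by_contra h
      exact hxC ⟨hx', h⟩
    · rcases eq_or_lt_of_le hx.1 with rfl | h1
      · obtain ⟨κ, hκ, ε, hε, h⟩ := right a ⟨le_rfl, hab⟩
        exact ⟨κ, hκ, ε, hε, fun y hy hyx => h y hy hy.1 hyx⟩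
      · have h2 : x = b := le_antisymm hx.2 (not_lt.1 fun h => hx' ⟨h1, h⟩)
        subst h2
        obtain ⟨κ, hκ, ε, hε, h⟩ := left x ⟨hab, le_rfl⟩
        exact ⟨κ, hκ, ε, hε, fun y hy hyx => h y hy hy.2 hyx⟩
  · obtain ⟨κ, hκ, ε, hε, h⟩ := right x ⟨hx.1.1.le, hx.1.2⟩
    obtain ⟨κ', hκ', ε', hε', h'⟩ := left x ⟨hx.1.1, hx.1.2.le⟩
    have hne : κ' ≠ κ := by
      rintro rfl
      refine hx.2 ⟨κ', hκ, min ε ε', lt_min hε hε', fun y hy hyx => ?_⟩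
      rcases le_total x y with hxy | hxy
      · exact h y hy hxy (hyx.trans_le (min_le_left _ _))
      · exact h' y hy hxy (hyx.trans_le (min_le_right _ _))
    have hneg : κ' = -κ := by
      rcases abs_eq_abs.1 (hκ'.trans hκ.symm) with h1 | h1
      · exact absurd h1 hne
      · exact h1
    refine ⟨κ, hκ, min ε ε', lt_min hε hε', fun y hy hyx => ?_⟩
    rcases le_total x y with hxy | hxy
    · rw [h y hy hxy (hyx.trans_le (min_le_left _ _)), abs_of_nonneg (by linarith)]
    · rw [h' y hy hxy (hyx.trans_le (min_le_right _ _)), abs_of_nonpos (by linarith), hneg]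
      ring

namespace IsFold

variable {a b A : ℝ} {C : Set ℝ} {g : ℝ → ℝ}

theorem abs_sub_eq (hg : IsFold a b A C g) {x : ℝ} (hx : x ∈ Icc a b) :
    ∃ ε > 0, ∀ y ∈ Icc a b, |y - x| < ε → |g y - g x| = A * |y - x| := by
  by_cases hxC : x ∈ C
  · obtain ⟨κ, hκ, ε, hε, h⟩ := hg.bent x hxC
    refine ⟨ε, hε, fun y hy hyx => ?_⟩
    rw [h y hy hyx, add_sub_cancel_left, abs_mul, hκ, abs_abs]
  · obtain ⟨κ, hκ, ε, hε, h⟩ := hg.straight x hx hxC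
    refine ⟨ε, hε, fun y hy hyx => ?_⟩
    rw [h y hy hyx, add_sub_cancel_left, abs_mul, hκ]

theorem continuousOn (hg : IsFold a b A C g) : ContinuousOn g (Icc a b) := by
  intro x hx
  obtain ⟨ε, hε, h⟩ := hg.abs_sub_eq hx
  have h1 : Tendsto (fun y => A * |y - x|) (𝓝[Icc a b] x) (𝓝 0) := by
    have : Continuous fun y => A * |y - x| := by fun_prop
    simpa using (this.tendsto x).mono_left nhdsWithin_le_nhds
  refine tendsto_iff_dist_tendsto_zero.2 (h1.congr' ?_)
  filter_upwards [self_mem_nhdsWithin, mem_nhdsWithin_of_mem_nhds (Metric.ball_mem_nhds x hε)]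
    with y hy hyx
  exact (h y hy hyx).symm

theorem comp_mul (hg : IsFold a b A C g) (c : ℝ) : IsFold a b (|c| * A) C fun x => c * g x := by
  refine ⟨hg.subset, fun x hx hxC => ?_, fun x hx => ?_⟩
  · obtain ⟨κ, hκ, ε, hε, h⟩ := hg.straight x hx hxC
    exact ⟨c * κ, by rw [abs_mul, hκ], ε, hε, fun y hy hyx => by simp only [h y hy hyx]; ring⟩
  · obtain ⟨κ, hκ, ε, hε, h⟩ := hg.bent x hx
    exact ⟨c * κ, by rw [abs_mul, hκ], ε, hε, fun y hy hyx => by simp only [h y hy hyx]; ring⟩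

/-- A value attained at an interior straight point is not extremal. -/
theorem exists_lt_gt (hg : IsFold a b A C g) (hA : 0 < A) {x : ℝ} (hx : x ∈ Ioo a b)
    (hxC : x ∉ C) : (∃ y ∈ Icc a b, g y < g x) ∧ ∃ y ∈ Icc a b, g x < g y := by
  obtain ⟨κ, hκ, ε, hε, h⟩ := hg.straight x (Ioo_subset_Icc_self hx) hxC
  obtain ⟨δ, hδ, hδε, h1, h2⟩ : ∃ δ > 0, δ < ε ∧ a ≤ x - δ ∧ x + δ ≤ b := by
    refine ⟨min (ε / 2) (min (x - a) (b - x)), ?_, ?_, ?_, ?_⟩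
    · exact lt_min (by linarith) (lt_min (by linarith [hx.1]) (by linarith [hx.2]))
    · exact (min_le_left _ _).trans_lt (by linarith)
    · linarith [(min_le_right (ε / 2) (min (x - a) (b - x))).trans (min_le_left _ _)]
    · linarith [(min_le_right (ε / 2) (min (x - a) (b - x))).trans (min_le_right _ _)]
  have hp : x + δ ∈ Icc a b := ⟨by linarith, h2⟩
  have hm : x - δ ∈ Icc a b := ⟨h1, by linarith⟩
  have ep := h _ hp (by rw [add_sub_cancel_left, abs_of_pos hδ]; exact hδε)
  have em := h _ hm (by rw [sub_sub_cancel_left, abs_neg, abs_of_pos hδ]; exact hδε)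
  rw [add_sub_cancel_left] at ep
  rw [sub_sub_cancel_left] at em
  rcases (abs_eq hA.le).1 hκ with rfl | rfl
  · have := mul_pos hA hδ
    exact ⟨⟨_, hm, by linarith⟩, _, hp, by linarith⟩
  · have := mul_pos hA hδ
    exact ⟨⟨_, hp, by linarith⟩, _, hm, by linarith⟩

/-- Every intermediate value is attained at an interior straight point. -/
theorem exists_straight_eq (hg : IsFold a b A C g) {v y₁ y₂ : ℝ} (h₁ : y₁ ∈ Icc a b)
    (h₂ : y₂ ∈ Icc a b) (hv₁ : g y₁ < v) (hv₂ : v < g y₂) : ∃ y ∈ Ioo a b, y ∉ C ∧ g y = v := by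
  wlog h12 : y₁ ≤ y₂ generalizing g v y₁ y₂
  · have hn : IsFold a b A C fun x => -1 * g x := by simpa using hg.comp_mul (-1)
    obtain ⟨y, hy, hyC, e⟩ := this hn (v := -v) h₂ h₁ (by simpa using hv₂) (by simpa using hv₁)
      (le_of_not_ge h12)
    exact ⟨y, hy, hyC, by linarith⟩
  -- The last passage through `v` has values below `v` arbitrarily close on the left and none on the
  -- right, so it cannot be a fold.
  set S : Set ℝ := {y ∈ Icc y₁ y₂ | g y < v} with hS
  have hsub : Icc y₁ y₂ ⊆ Icc a b := Icc_subset_Icc h₁.1 h₂.2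
  have hne : S.Nonempty := ⟨y₁, ⟨le_rfl, h12⟩, hv₁⟩
  have hbd : BddAbove S := ⟨y₂, fun y hy => hy.1.2⟩
  have hlub := isLUB_csSup hne hbd
  set z := sSup S
  have hz12 : z ∈ Icc y₁ y₂ := ⟨hlub.1 ⟨⟨le_rfl, h12⟩, hv₁⟩, hlub.2 fun y hy => hy.1.2⟩
  have hz := hsub hz12
  have hc := hg.continuousOn z hz
  have hge : ∀ y ∈ Icc y₁ y₂, z < y → v ≤ g y := fun y hy hzy => by
    by_contra! h
    exact absurd (hlub.1 ⟨hy, h⟩) (not_le.2 hzy)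
  have hle : g z ≤ v := by
    by_contra! h
    obtain ⟨ε, hε, hb⟩ := Metric.mem_nhdsWithin_iff.1 (hc.eventually (lt_mem_nhds h))
    obtain ⟨y, hy, hy1, hy2⟩ := hlub.exists_between (show z - ε < z by linarith)
    have := hb ⟨show y ∈ Metric.ball z ε by
      rw [Metric.mem_ball, Real.dist_eq, abs_lt]; constructor <;> linarith, hsub hy.1⟩
    exact absurd hy.2 (not_lt.2 (le_of_lt this))
  have hz2 : z < y₂ := lt_of_le_of_ne hz12.2 (by rintro h; rw [h] at hle; linarith)
  have hzv : g z = v := by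
    refine le_antisymm hle ?_
    by_contra! h
    obtain ⟨ε, hε, hb⟩ := Metric.mem_nhdsWithin_iff.1 (hc.eventually (gt_mem_nhds h))
    set y := min (z + ε / 2) y₂
    have hzy : z < y := lt_min (by linarith) hz2
    have hy12 : y ∈ Icc y₁ y₂ := ⟨hz12.1.trans hzy.le, min_le_right _ _⟩
    have := hb ⟨show y ∈ Metric.ball z ε by
      rw [Metric.mem_ball, Real.dist_eq, abs_lt]
      constructor <;> linarith [min_le_left (z + ε / 2) y₂], hsub hy12⟩
    exact absurd (hge y hy12 hzy) (not_le.2 this)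
  have hz1 : y₁ < z := lt_of_le_of_ne hz12.1 (by rintro h; rw [← h] at hzv; linarith)
  refine ⟨z, ⟨h₁.1.trans_lt hz1, hz2.trans_le h₂.2⟩, fun hzC => ?_, hzv⟩
  obtain ⟨κ, -, ε, hε, h⟩ := hg.bent z hzC
  obtain ⟨y, hy, hy1, hy2⟩ := hlub.exists_between
    (show max (z - ε) (z - (y₂ - z)) < z from max_lt (by linarith) (by linarith))
  rw [max_lt_iff] at hy1
  have hyz : y ≠ z := by
    rintro rfl
    exact absurd hy.2 (by rw [hzv]; exact lt_irrefl _)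
  have hyz' := lt_of_le_of_ne hy2 hyz
  -- At a bend the mirror image of `y` in `z` has the same value, which is below `v` but to the
  -- right of `z`.
  have hw : 2 * z - y ∈ Icc y₁ y₂ := ⟨by linarith, by linarith⟩
  have e1 := h y (hsub hy.1) (by rw [abs_lt]; constructor <;> linarith)
  have e2 := h (2 * z - y) (hsub hw) (by rw [abs_lt]; constructor <;> linarith)
  have e3 : |2 * z - y - z| = |y - z| := by rw [← abs_neg]; congr 1; ring
  rw [e3, ← e1] at e2
  have := hge _ hw (by linarith)
  linarith [hy.2]

end IsFold

/-! ### Distance to a set of reals -/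

section InfDist

variable {N : Set ℝ} {x : ℝ}

/-- The nearer of the two equidistant points gives the upper bound; the lower bound is that the
distance is 1-Lipschitz. -/
theorem infDist_near_of_both
    (h1 : x - Metric.infDist x N ∈ closure N) (h2 : x + Metric.infDist x N ∈ closure N) :
    ∀ y, |y - x| < Metric.infDist x N → Metric.infDist y N = Metric.infDist x N - |y - x| := by
  intro y hy
  set r := Metric.infDist x N with hr
  have a1 := Metric.infDist_le_dist_of_mem (x := y) h1
  have a2 := Metric.infDist_le_dist_of_mem (x := y) h2
  have a3 := Metric.infDist_le_infDist_add_dist (s := N) (x := x) (y := y)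
  rw [Metric.infDist_closure, Real.dist_eq] at a1 a2
  rw [Real.dist_eq, abs_sub_comm] at a3
  refine le_antisymm ?_ (by linarith)
  rcases abs_cases (y - x) with ⟨e, h⟩ | ⟨e, h⟩ <;> rw [e] at hy ⊢
  · rw [abs_of_nonpos (by linarith)] at a2; linarith
  · rw [abs_of_nonneg (by linarith)] at a1; linarith

/-- On the right the points of `N` are farther away by some `η`, so the left point stays nearest
while `x` moves by less than `η / 2`. -/
theorem infDist_near_of_left (hN : N.Nonempty) (h0 : 0 < Metric.infDist x N)
    (h1 : x - Metric.infDist x N ∈ closure N) (h2 : x + Metric.infDist x N ∉ closure N) :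
    ∃ ε > 0, ∀ y, |y - x| < ε → Metric.infDist y N = Metric.infDist x N + (y - x) := by
  set r := Metric.infDist x N with hr
  obtain ⟨η, hη, hb⟩ := Metric.isOpen_iff.1 isClosed_closure.isOpen_compl _ h2
  refine ⟨min r (η / 2), lt_min h0 (by linarith), fun y hy => ?_⟩
  obtain ⟨hy1, hy2⟩ := lt_min_iff.1 hy
  have a1 := Metric.infDist_le_dist_of_mem (x := y) h1
  rw [Metric.infDist_closure, Real.dist_eq, abs_of_nonneg (by linarith [(abs_lt.1 hy1).1])] at a1
  refine le_antisymm (by linarith) ((Metric.le_infDist hN).2 fun n hn => ?_)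
  have a2 := Metric.infDist_le_dist_of_mem (x := x) hn
  rw [← hr, Real.dist_eq] at a2
  rw [Real.dist_eq]
  rcases le_abs.1 a2 with h | h
  · exact le_abs.2 (Or.inl (by linarith))
  · have : x + r + η ≤ n := by
      by_contra! hlt
      refine hb (show n ∈ Metric.ball (x + r) η from ?_) (subset_closure hn)
      rw [Metric.mem_ball, Real.dist_eq, abs_lt]
      constructor <;> linarith
    exact le_abs.2 (Or.inr (by linarith [(abs_lt.1 hy2).2]))

theorem infDist_near_of_right (hN : N.Nonempty) (h0 : 0 < Metric.infDist x N)
    (h1 : x - Metric.infDist x N ∉ closure N) (h2 : x + Metric.infDist x N ∈ closure N) :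
    ∃ ε > 0, ∀ y, |y - x| < ε → Metric.infDist y N = Metric.infDist x N - (y - x) := by
  set r := Metric.infDist x N with hr
  obtain ⟨η, hη, hb⟩ := Metric.isOpen_iff.1 isClosed_closure.isOpen_compl _ h1
  refine ⟨min r (η / 2), lt_min h0 (by linarith), fun y hy => ?_⟩
  obtain ⟨hy1, hy2⟩ := lt_min_iff.1 hy
  have a1 := Metric.infDist_le_dist_of_mem (x := y) h2
  rw [Metric.infDist_closure, Real.dist_eq, abs_of_nonpos (by linarith [(abs_lt.1 hy1).2])] at a1
  refine le_antisymm (by linarith) ((Metric.le_infDist hN).2 fun n hn => ?_)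
  have a2 := Metric.infDist_le_dist_of_mem (x := x) hn
  rw [← hr, Real.dist_eq] at a2
  rw [Real.dist_eq]
  rcases le_abs.1 a2 with h | h
  · have : n ≤ x - r - η := by
      by_contra! hlt
      refine hb (show n ∈ Metric.ball (x - r) η from ?_) (subset_closure hn)
      rw [Metric.mem_ball, Real.dist_eq, abs_lt]
      constructor <;> linarith
    exact le_abs.2 (Or.inl (by linarith [(abs_lt.1 hy2).1]))
  · exact le_abs.2 (Or.inr (by linarith))

theorem mem_closure_of_infDist (hN : N.Nonempty) :
    x - Metric.infDist x N ∈ closure N ∨ x + Metric.infDist x N ∈ closure N := by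
  obtain ⟨y, hy, e⟩ := isClosed_closure.exists_infDist_eq_dist hN.closure x
  rw [Metric.infDist_closure, Real.dist_eq] at e
  rcases abs_cases (x - y) with ⟨e', -⟩ | ⟨e', -⟩ <;> rw [e, e']
  · left; convert hy using 1; ring
  · right; convert hy using 1; ring

end InfDist

/-! ### Replacing the creases of a fold function by the centres of the stripes -/

/-- `[s, t]` is a maximal closed interval contained in `L`, and lies strictly inside `[a, b]`. -/
def IsMaximalIcc (L : Set ℝ) (a b s t : ℝ) : Prop :=
  a < s ∧ s ≤ t ∧ t < b ∧ Icc s t ⊆ L ∧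
    ∀ s' t', s' ≤ s → t ≤ t' → Icc s' t' ⊆ L → s' = s ∧ t' = t

/-- The straight interior positions at which `F` takes a value strictly between `m` and `M`. -/
def crossed (a b m M : ℝ) (C : Set ℝ) (F : ℝ → ℝ) : Set ℝ :=
  {x | x ∈ Ioo a b ∧ x ∉ C ∧ F x ∈ Ioo m M}

namespace IsFold

variable {a b A m M : ℝ} {C : Set ℝ} {F : ℝ → ℝ}

theorem isOpen_crossed (hF : IsFold a b A C F) (hC : C.Finite) :
    IsOpen (crossed a b m M C F) := by
  have h1 : IsOpen (Ioo a b ∩ F ⁻¹' Ioo m M) :=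
    (hF.continuousOn.mono Ioo_subset_Icc_self).isOpen_inter_preimage isOpen_Ioo isOpen_Ioo
  have : crossed a b m M C F = (Ioo a b ∩ F ⁻¹' Ioo m M) ∩ Cᶜ := by
    ext x; simp only [crossed, mem_ofPred_eq, mem_inter_iff, mem_preimage, mem_compl_iff]; tauto
  rw [this]
  exact h1.inter hC.isClosed.isOpen_compl

theorem closure_crossed_subset : closure (crossed a b m M C F) ⊆ Icc a b :=
  closure_minimal (fun _ hx => Ioo_subset_Icc_self hx.1) isClosed_Icc

theorem mem_Icc_of_mem_closure (hF : IsFold a b A C F) {x : ℝ}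
    (hx : x ∈ closure (crossed a b m M C F)) : F x ∈ Icc m M := by
  have hcl : IsClosed (Icc a b ∩ F ⁻¹' Icc m M) :=
    hF.continuousOn.preimage_isClosed_of_isClosed isClosed_Icc isClosed_Icc
  have hsub : crossed a b m M C F ⊆ Icc a b ∩ F ⁻¹' Icc m M :=
    fun y hy => ⟨Ioo_subset_Icc_self hy.1, Ioo_subset_Icc_self hy.2.2⟩
  exact (closure_minimal hsub hcl hx).2

/-- Having a value in `(m, M)` is an open condition on `[a, b]`, and the positions excluded besides
(creases and ends) are finitely many. -/
theorem mem_closure_crossed (hF : IsFold a b A C F) (hC : C.Finite) (hab : a < b) {x : ℝ}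
    (hx : x ∈ Icc a b) (hv : F x ∈ Ioo m M) : x ∈ closure (crossed a b m M C F) := by
  have hd : x ∈ closure (Ioo a b ∩ Cᶜ) := by
    have h1 : Ioo a b ⊆ closure (Ioo a b ∩ Cᶜ) :=
      (hC.countable.dense_compl ℝ).open_subset_closure_inter isOpen_Ioo
    have h2 := closure_minimal h1 isClosed_closure
    rw [closure_Ioo hab.ne] at h2
    exact h2 hx
  have hev := (hF.continuousOn x hx).eventually (isOpen_Ioo.mem_nhds hv)
  rw [Metric.mem_closure_iff] at hd ⊢
  intro ε hε
  obtain ⟨δ, hδ, hb⟩ := Metric.mem_nhdsWithin_iff.1 hev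
  obtain ⟨y, hy, hyx⟩ := hd (min ε δ) (lt_min hε hδ)
  refine ⟨y, ⟨hy.1, hy.2, hb ⟨?_, Ioo_subset_Icc_self hy.1⟩⟩, hyx.trans_le (min_le_left _ _)⟩
  rw [Metric.mem_ball, dist_comm]
  exact hyx.trans_le (min_le_right _ _)

/-- On one side of `x` the function is affine. Starting from a value in `[m, M]` and moving towards
one in `(m, M)`, it is strictly inside at once. -/
theorem exists_segment_crossed (hF : IsFold a b A C F) (hC : C.Finite) {x : ℝ}
    (hx : x ∈ closure (crossed a b m M C F)) (hxN : x ∉ crossed a b m M C F) {ε : ℝ}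
    (hε : 0 < ε) : ∃ n ≠ x, |n - x| < ε ∧ ∀ τ ∈ Ioc (0 : ℝ) 1,
      x + τ * (n - x) ∈ crossed a b m M C F := by
  have hxI := closure_crossed_subset hx
  have hxv := hF.mem_Icc_of_mem_closure hx
  obtain ⟨δ, hδ, hg⟩ := exists_gap hC x
  have key : ∃ ρ > 0, ∀ n ∈ Icc a b, |n - x| < ρ → ∀ τ ∈ Ioc (0 : ℝ) 1,
      F (x + τ * (n - x)) = F x + τ * (F n - F x) := by
    have aux : ∀ n ∈ Icc a b, ∀ ρ, |n - x| < ρ → ∀ τ ∈ Ioc (0 : ℝ) 1,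
        x + τ * (n - x) ∈ Icc a b ∧ |x + τ * (n - x) - x| < ρ := by
      intro n hn ρ hnρ τ hτ
      refine ⟨?_, ?_⟩
      · have := (convex_Icc a b).add_smul_sub_mem hxI hn ⟨hτ.1.le, hτ.2⟩
        simpa using this
      · rw [add_sub_cancel_left, abs_mul, abs_of_pos hτ.1]
        exact (mul_le_of_le_one_left (abs_nonneg _) hτ.2).trans_lt hnρ
    by_cases hxC : x ∈ C
    · obtain ⟨κ, -, ρ, hρ, h⟩ := hF.bent x hxC
      refine ⟨ρ, hρ, fun n hn hnx τ hτ => ?_⟩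
      obtain ⟨h1, h2⟩ := aux n hn ρ hnx τ hτ
      rw [h _ h1 h2, h n hn hnx, add_sub_cancel_left, abs_mul, abs_of_pos hτ.1]
      ring
    · obtain ⟨κ, -, ρ, hρ, h⟩ := hF.straight x hxI hxC
      refine ⟨ρ, hρ, fun n hn hnx τ hτ => ?_⟩
      obtain ⟨h1, h2⟩ := aux n hn ρ hnx τ hτ
      rw [h _ h1 h2, h n hn hnx]
      ring
  obtain ⟨ρ, hρ, hseg⟩ := key
  obtain ⟨n, hn, hd⟩ := Metric.mem_closure_iff.1 hx (min ε (min δ ρ))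
    (lt_min hε (lt_min hδ hρ))
  rw [dist_comm, Real.dist_eq, lt_min_iff, lt_min_iff] at hd
  have hne : n ≠ x := by rintro rfl; exact hxN hn
  refine ⟨n, hne, hd.1, fun τ hτ => ⟨?_, fun hτC => ?_, ?_⟩⟩
  · have h1 := hn.1
    rcases lt_or_gt_of_ne hne with h | h
    · constructor <;> nlinarith [hτ.1, hτ.2, h1.1, h1.2, hxI.1, hxI.2]
    · constructor <;> nlinarith [hτ.1, hτ.2, h1.1, h1.2, hxI.1, hxI.2]
  · have h1 := hg _ hτC (by
      rw [add_sub_cancel_left, abs_mul, abs_of_pos hτ.1]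
      exact (mul_le_of_le_one_left (abs_nonneg _) hτ.2).trans_lt hd.2.1)
    have : τ * (n - x) ≠ 0 := mul_ne_zero hτ.1.ne' (sub_ne_zero.2 hne)
    exact this (by linarith)
  · rw [hseg n (Ioo_subset_Icc_self hn.1) hd.2.2 τ hτ]
    have h2 := hn.2.2
    constructor <;> nlinarith [hτ.1, hτ.2, h2.1, h2.2, hxv.1, hxv.2]

/-- One side of `x` lies in `N`, and `F` is symmetric about the crease, so the other side does too.
This makes such a crease a zero-width stripe. -/
theorem bent_near_crossed (hF : IsFold a b A C F) (hC : C.Finite) {x : ℝ} (hxC : x ∈ C)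
    (hx : x ∈ closure (crossed a b m M C F)) :
    ∃ δ > 0, ∀ y, y ≠ x → |y - x| < δ → y ∈ crossed a b m M C F := by
  have hxI := hF.subset hxC
  obtain ⟨δ, hδ, hg⟩ := exists_gap hC x
  obtain ⟨κ, -, ρ, hρ, h⟩ := hF.bent x hxC
  obtain ⟨η, hη, hb⟩ := Metric.isOpen_iff.1 isOpen_Ioo x hxI
  obtain ⟨n, hne, hn, hs⟩ := hF.exists_segment_crossed hC hx (fun h => h.2.1 hxC)
    (lt_min hδ (lt_min hρ hη))
  have hpos : 0 < |n - x| := abs_pos.2 (sub_ne_zero.2 hne)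
  refine ⟨|n - x|, hpos, fun y hyx hy => ?_⟩
  have hy' := hy.trans hn
  rw [lt_min_iff, lt_min_iff] at hy'
  have hyI : y ∈ Ioo a b := hb (show y ∈ Metric.ball x η from hy'.2.2)
  refine ⟨hyI, fun hyC => hyx (hg y hyC hy'.1), ?_⟩
  have hτ : |y - x| / |n - x| ∈ Ioc (0 : ℝ) 1 :=
    ⟨div_pos (abs_pos.2 (sub_ne_zero.2 hyx)) hpos, (div_le_one hpos).2 hy.le⟩
  have h1 := hs _ hτ
  set z := x + |y - x| / |n - x| * (n - x) with hz
  have h2 : |z - x| = |y - x| := by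
    rw [hz, add_sub_cancel_left, abs_mul, abs_div, abs_abs, abs_abs, div_mul_cancel₀ _ hpos.ne']
  have h3 : F y = F z := by
    rw [h y (Ioo_subset_Icc_self hyI) hy'.2.1,
      h z (Ioo_subset_Icc_self h1.1) (by rw [h2]; exact hy'.2.1), h2]
  rw [h3]
  exact h1.2.2

/-- A straight boundary point of `N` inside the paper has the value `m` or `M`; `F` enters `(m, M)`
in the direction `e` and leaves `[m, M]` with slope `A` in the other. -/
theorem straight_near_crossed (hF : IsFold a b A C F) (hC : C.Finite) {x : ℝ}
    (hx : x ∈ closure (crossed a b m M C F)) (hxN : x ∉ crossed a b m M C F) (hxC : x ∉ C) :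
    ∃ e : ℝ, (e = 1 ∨ e = -1) ∧ ∃ δ > 0, ∀ τ ∈ Ioo 0 δ, x + e * τ ∈ crossed a b m M C F ∧
      (x - e * τ ∈ Icc a b →
        F x = M ∧ F (x - e * τ) = M + A * τ ∨ F x = m ∧ F (x - e * τ) = m - A * τ) := by
  have hxI := closure_crossed_subset hx
  have hxv := hF.mem_Icc_of_mem_closure hx
  obtain ⟨κ, hκ, ρ, hρ, h⟩ := hF.straight x hxI hxC
  obtain ⟨n, hne, hn, hs⟩ := hF.exists_segment_crossed hC hx hxN hρ
  have hpos : 0 < |n - x| := abs_pos.2 (sub_ne_zero.2 hne)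
  obtain ⟨e, he, hen⟩ : ∃ e : ℝ, (e = 1 ∨ e = -1) ∧ n - x = e * |n - x| := by
    rcases abs_cases (n - x) with ⟨h, -⟩ | ⟨h, -⟩
    · exact ⟨1, Or.inl rfl, by rw [h]; ring⟩
    · exact ⟨-1, Or.inr rfl, by rw [h]; ring⟩
  have he1 : |e| = 1 := by rcases he with rfl | rfl <;> simp
  refine ⟨e, he, |n - x|, hpos, fun τ hτ => ?_⟩
  have h1 := hs (τ / |n - x|) ⟨div_pos hτ.1 hpos, (div_le_one hpos).2 hτ.2.le⟩
  have h2 : τ / |n - x| * (n - x) = e * τ := by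
    rw [hen, abs_mul, abs_abs, he1]
    field_simp
  rw [h2] at h1
  refine ⟨h1, fun hy => ?_⟩
  have heτ : |e * τ| = τ := by rw [abs_mul, he1, one_mul, abs_of_pos hτ.1]
  have e1 := h _ (Ioo_subset_Icc_self h1.1) (by rw [add_sub_cancel_left, heτ]; exact hτ.2.trans hn)
  have e2 := h _ hy (by rw [sub_sub_cancel_left, abs_neg, heτ]; exact hτ.2.trans hn)
  rw [add_sub_cancel_left] at e1
  rw [sub_sub_cancel_left] at e2
  have hxo : x ∈ Ioo a b := by
    have h3 := h1.1
    rcases he with rfl | rfl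
    · constructor <;> linarith [hy.1, hτ.1, h3.1, h3.2, hxI.2]
    · constructor <;> linarith [hy.1, hτ.1, h3.1, h3.2, hy.2]
  have hvn : F x ∉ Ioo m M := fun hv => hxN ⟨hxo, hxC, hv⟩
  have hv1 := h1.2.2
  rw [e1] at hv1
  have hAe : κ * (e * τ) = A * τ ∨ κ * (e * τ) = -(A * τ) := by
    rcases abs_choice κ with h | h <;> rw [h] at hκ <;> rcases he with rfl | rfl <;>
      rw [← hκ] <;> [left; right; right; left] <;> ring
  have hA : 0 ≤ A * τ := mul_nonneg (hκ ▸ abs_nonneg κ) hτ.1.le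
  rw [e2]
  by_cases hm : F x ≤ m
  · have := le_antisymm hm hxv.1
    right
    refine ⟨this, ?_⟩
    rcases hAe with h | h <;> linarith [hv1.1]
  · have hM : M ≤ F x := by
      by_contra! hM
      exact hvn ⟨not_le.1 hm, hM⟩
    have := le_antisymm hxv.2 hM
    left
    refine ⟨this, ?_⟩
    rcases hAe with h | h <;> linarith [hv1.2]

/-- The fold function that has its creases at the centres of the stripes. -/
noncomputable def recentre (A m M : ℝ) (N : Set ℝ) (F : ℝ → ℝ) (x : ℝ) : ℝ :=
  open Classical in
  if Metric.infDist x N = 0 then F x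
  else if M ≤ F x then M + A * Metric.infDist x N else m - A * Metric.infDist x N

theorem recentre_of_mem {N : Set ℝ} {x : ℝ} (hx : x ∈ closure N) :
    recentre A m M N F x = F x := by
  have hne : N.Nonempty := closure_nonempty_iff.1 ⟨x, hx⟩
  rw [recentre, if_pos ((Metric.mem_closure_iff_infDist_zero hne).1 hx)]

/-- Just outside `closure N` the function `F` already departs from `m` or `M` at rate `A` times the
distance to `N`, so the two formulas fit together. -/
theorem recentre_near (hF : IsFold a b A C F) (hC : C.Finite) (hmM : m < M) {x : ℝ}
    (hA : 0 < A) (hx : x ∈ closure (crossed a b m M C F)) :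
    ∃ ε > 0, ∀ y ∈ Icc a b, |y - x| < ε → recentre A m M (crossed a b m M C F) F y = F y := by
  set N := crossed a b m M C F with hN
  have hne : N.Nonempty := closure_nonempty_iff.1 ⟨x, hx⟩
  by_cases hxN : x ∈ N
  · obtain ⟨ε, hε, hb⟩ := Metric.isOpen_iff.1 (hF.isOpen_crossed (m := m) (M := M) hC) x hxN
    exact ⟨ε, hε, fun y _ hy => recentre_of_mem (subset_closure (hb hy))⟩
  by_cases hxC : x ∈ C
  · obtain ⟨ε, hε, h⟩ := hF.bent_near_crossed hC hxC hx
    refine ⟨ε, hε, fun y _ hy => recentre_of_mem ?_⟩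
    by_cases hyx : y = x
    · rwa [hyx]
    · exact subset_closure (h y hyx hy)
  obtain ⟨e, he, δ, hδ, h⟩ := hF.straight_near_crossed hC hx hxN hxC
  have hee : e * e = 1 := by rcases he with rfl | rfl <;> norm_num
  have he1 : |e| = 1 := by rcases he with rfl | rfl <;> simp
  -- A point of `N` closer to `y` than `x` is lies within `2 * |y - x|` of `x`; halving keeps it in
  -- the range where the outer side is known to avoid `N`.
  refine ⟨δ / 2, by linarith, fun y hy hyx => ?_⟩
  by_cases hyx0 : y = x
  · rw [hyx0]; exact recentre_of_mem hx
  have hpos : 0 < |y - x| := abs_pos.2 (sub_ne_zero.2 hyx0)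
  have hτ : |y - x| ∈ Ioo 0 δ := ⟨hpos, by linarith⟩
  have hcase : y = x + e * |y - x| ∨ y = x - e * |y - x| := by
    rcases abs_choice (y - x) with h | h <;> rw [h] <;> rcases he with rfl | rfl <;>
      [left; right; right; left] <;> ring
  rcases hcase with hy1 | hy1
  · rw [hy1]
    exact recentre_of_mem (subset_closure (h _ hτ).1)
  have hD : Metric.infDist y N = |y - x| := by
    refine le_antisymm ?_ ((Metric.le_infDist hne).2 fun n hn => ?_)
    · have := Metric.infDist_le_dist_of_mem (x := y) hx
      rwa [Metric.infDist_closure, Real.dist_eq] at this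
    by_contra! hlt
    rw [Real.dist_eq, abs_sub_comm] at hlt
    have hnx : |n - x| < δ := by
      have := abs_add_le (n - y) (y - x)
      rw [sub_add_sub_cancel] at this
      linarith
    have hnx0 : n ≠ x := by rintro rfl; exact hxN hn
    have hn1 : n = x - e * |n - x| := by
      rcases he with rfl | rfl
      · rw [abs_of_nonpos]
        · ring
        · by_contra! hc
          linarith [(abs_lt.1 hlt).2]
      · rw [abs_of_nonneg]
        · ring
        · by_contra! hc
          linarith [(abs_lt.1 hlt).1]
    have hnp : 0 < |n - x| := abs_pos.2 (sub_ne_zero.2 hnx0)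
    have h2 := (h |n - x| ⟨hnp, hnx⟩).2 (by rw [← hn1]; exact Ioo_subset_Icc_self hn.1)
    rw [← hn1] at h2
    have h3 := hn.2.2
    have := mul_pos hA hnp
    rcases h2 with ⟨-, h2⟩ | ⟨-, h2⟩ <;> linarith [h3.1, h3.2]
  have h2 := (h _ hτ).2 (by rw [← hy1]; exact hy)
  rw [← hy1] at h2
  have := mul_pos hA hpos
  rw [recentre, if_neg (by rw [hD]; exact hpos.ne'), hD]
  rcases h2 with ⟨-, h2⟩ | ⟨-, h2⟩
  · rw [if_pos (by linarith), h2]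
  · rw [if_neg (by linarith), h2]

/-- Off `closure N` the values of `F` avoid `(m, M)`, so by continuity the choice between `M ≤ F`
and `F ≤ m` is locally constant. -/
theorem recentre_far (hF : IsFold a b A C F) (hC : C.Finite) (hab : a < b) (hmM : m < M)
    (hne : (crossed a b m M C F).Nonempty) {x : ℝ} (hxI : x ∈ Icc a b)
    (hx : x ∉ closure (crossed a b m M C F)) :
    ∃ σ k : ℝ, |σ| = 1 ∧ ((σ = 1 ∧ k = M) ∨ (σ = -1 ∧ k = m)) ∧ ∃ ε > 0, ∀ y ∈ Icc a b,
      |y - x| < ε → recentre A m M (crossed a b m M C F) F y =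
        k + σ * A * Metric.infDist y (crossed a b m M C F) := by
  set N := crossed a b m M C F with hN
  obtain ⟨ε, hε, hb⟩ := Metric.isOpen_iff.1 isClosed_closure.isOpen_compl _ hx
  have hout : ∀ y ∈ Icc a b, |y - x| < ε → F y ∉ Ioo m M := fun y hy hyx hv =>
    hb (show y ∈ Metric.ball x ε from hyx) (hF.mem_closure_crossed hC hab hy hv)
  have hD : ∀ y, |y - x| < ε → Metric.infDist y N ≠ 0 := fun y hyx h0 =>
    hb (show y ∈ Metric.ball x ε from hyx) ((Metric.mem_closure_iff_infDist_zero hne).2 h0)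
  have hc := hF.continuousOn x hxI
  by_cases hM : M ≤ F x
  · obtain ⟨δ, hδ, hb'⟩ := Metric.mem_nhdsWithin_iff.1
      (hc.eventually (lt_mem_nhds (hmM.trans_le hM)))
    refine ⟨1, M, by simp, Or.inl ⟨rfl, rfl⟩, min ε δ, lt_min hε hδ, fun y hy hyx => ?_⟩
    obtain ⟨h1, h2⟩ := lt_min_iff.1 hyx
    have h3 : m < F y := hb' ⟨show y ∈ Metric.ball x δ from h2, hy⟩
    have h4 : M ≤ F y := by
      by_contra! h
      exact hout y hy h1 ⟨h3, h⟩
    rw [recentre, if_neg (hD y h1), if_pos h4]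
    ring
  · obtain ⟨δ, hδ, hb'⟩ := Metric.mem_nhdsWithin_iff.1
      (hc.eventually (gt_mem_nhds (not_le.1 hM)))
    refine ⟨-1, m, by simp, Or.inr ⟨rfl, rfl⟩, min ε δ, lt_min hε hδ, fun y hy hyx => ?_⟩
    obtain ⟨h1, h2⟩ := lt_min_iff.1 hyx
    have h3 : F y < M := hb' ⟨show y ∈ Metric.ball x δ from h2, hy⟩
    rw [recentre, if_neg (hD y h1), if_neg (not_le.2 h3)]
    ring


/-- Otherwise the interval could be prolonged past that end, which is strictly inside the paper. -/
theorem mem_closure_of_isMaximalIcc {N : Set ℝ} {s t : ℝ}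
    (h : IsMaximalIcc (Icc a b \ N) a b s t) : s ∈ closure N ∧ t ∈ closure N := by
  obtain ⟨has, hst, htb, hL, hmax⟩ := h
  constructor
  · by_contra hs
    obtain ⟨ε, hε, hb⟩ := Metric.isOpen_iff.1 isClosed_closure.isOpen_compl _ hs
    set s' := max a (s - ε / 2)
    have hs' : s' < s := max_lt has (by linarith)
    refine hs'.ne (hmax s' t hs'.le le_rfl fun y hy => ?_).1
    rcases le_or_gt s y with h | h
    · exact hL ⟨h, hy.2⟩
    · refine ⟨⟨(le_max_left _ _).trans hy.1, by linarith⟩, fun hyN => ?_⟩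
      have h1 := (le_max_right a (s - ε / 2)).trans hy.1
      exact hb (show y ∈ Metric.ball s ε by
        rw [Metric.mem_ball, Real.dist_eq, abs_lt]; constructor <;> linarith) (subset_closure hyN)
  · by_contra ht
    obtain ⟨ε, hε, hb⟩ := Metric.isOpen_iff.1 isClosed_closure.isOpen_compl _ ht
    set t' := min b (t + ε / 2)
    have ht' : t < t' := lt_min htb (by linarith)
    refine ht'.ne' (hmax s t' le_rfl ht'.le fun y hy => ?_).2
    rcases le_or_gt y t with h | h
    · exact hL ⟨hy.1, h⟩
    · refine ⟨⟨by linarith, hy.2.trans (min_le_left _ _)⟩, fun hyN => ?_⟩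
      have h1 := hy.2.trans (min_le_right b (t + ε / 2))
      exact hb (show y ∈ Metric.ball t ε by
        rw [Metric.mem_ball, Real.dist_eq, abs_lt]; constructor <;> linarith) (subset_closure hyN)

/-- Since `N` is open, its points accumulating at `s` and `t` lie strictly beyond them. They block
any enlargement and separate the gap from the edges. -/
theorem isMaximalIcc_of_mem_closure {N : Set ℝ} (hNo : IsOpen N) (hNI : N ⊆ Ioo a b) {s t : ℝ}
    (hst : s < t) (hs : s ∈ closure N) (ht : t ∈ closure N) (hN : ∀ y ∈ Ioo s t, y ∉ N) :
    IsMaximalIcc (Icc a b \ N) a b s t := by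
  have hl : ∀ ε > 0, ∃ n ∈ N, n < s ∧ s - ε < n := by
    intro ε hε
    obtain ⟨n, hn, hd⟩ := Metric.mem_closure_iff.1 hs (min ε (t - s))
      (lt_min hε (by linarith))
    rw [dist_comm, Real.dist_eq, lt_min_iff, abs_lt, abs_lt] at hd
    have hns : n ≤ s := by
      by_contra! h
      exact hN n ⟨h, by linarith⟩ hn
    obtain ⟨η, hη, hb⟩ := Metric.isOpen_iff.1 hNo n hn
    refine ⟨n, hn, lt_of_le_of_ne hns ?_, by linarith⟩
    rintro rfl
    obtain ⟨y, hy1, hy2⟩ := exists_between (show n < min (n + η) t from lt_min (by linarith) hst)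
    rw [lt_min_iff] at hy2
    exact hN y ⟨hy1, hy2.2⟩ (hb (show y ∈ Metric.ball n η by
      rw [Metric.mem_ball, Real.dist_eq, abs_lt]; constructor <;> linarith))
  have hr : ∀ ε > 0, ∃ n ∈ N, t < n ∧ n < t + ε := by
    intro ε hε
    obtain ⟨n, hn, hd⟩ := Metric.mem_closure_iff.1 ht (min ε (t - s))
      (lt_min hε (by linarith))
    rw [dist_comm, Real.dist_eq, lt_min_iff, abs_lt, abs_lt] at hd
    have hns : t ≤ n := by
      by_contra! h
      exact hN n ⟨by linarith, h⟩ hn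
    obtain ⟨η, hη, hb⟩ := Metric.isOpen_iff.1 hNo n hn
    refine ⟨n, hn, lt_of_le_of_ne hns ?_, by linarith⟩
    rintro rfl
    obtain ⟨y, hy1, hy2⟩ := exists_between (show max (t - η) s < t from max_lt (by linarith) hst)
    rw [max_lt_iff] at hy1
    exact hN y ⟨hy1.2, hy2⟩ (hb (show y ∈ Metric.ball t η by
      rw [Metric.mem_ball, Real.dist_eq, abs_lt]; constructor <;> linarith))
  obtain ⟨n, hn, hns, -⟩ := hl 1 one_pos
  obtain ⟨n', hn', hnt, -⟩ := hr 1 one_pos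
  have has : a < s := (hNI hn).1.trans hns
  have htb : t < b := hnt.trans (hNI hn').2
  refine ⟨has, hst.le, htb, fun y hy => ⟨⟨by linarith [hy.1], by linarith [hy.2]⟩, fun hyN => ?_⟩,
    fun s' t' hs' ht' hL => ⟨?_, ?_⟩⟩
  · obtain ⟨η, hη, hb⟩ := Metric.isOpen_iff.1 hNo y hyN
    have hmid : (s + t) / 2 ∈ Ioo s t := ⟨by linarith, by linarith⟩
    rcases le_total y ((s + t) / 2) with h | h
    · obtain ⟨z, hz1, hz2⟩ := exists_between (show y < min (y + η) t from
        lt_min (by linarith) (h.trans_lt hmid.2))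
      rw [lt_min_iff] at hz2
      exact hN z ⟨by linarith [hy.1], hz2.2⟩ (hb (show z ∈ Metric.ball y η by
        rw [Metric.mem_ball, Real.dist_eq, abs_lt]; constructor <;> linarith))
    · obtain ⟨z, hz1, hz2⟩ := exists_between (show max (y - η) s < y from
        max_lt (by linarith) (hmid.1.trans_le h))
      rw [max_lt_iff] at hz1
      exact hN z ⟨hz1.2, by linarith [hy.2]⟩ (hb (show z ∈ Metric.ball y η by
        rw [Metric.mem_ball, Real.dist_eq, abs_lt]; constructor <;> linarith))
  · by_contra hne
    obtain ⟨n, hn, h1, h2⟩ := hl (s - s') (by linarith [lt_of_le_of_ne hs' hne])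
    exact (hL ⟨by linarith, by linarith⟩ : n ∈ Icc a b \ N).2 hn
  · by_contra hne
    obtain ⟨n, hn, h1, h2⟩ := hr (t' - t) (by linarith [lt_of_le_of_ne ht' (Ne.symm hne)])
    exact (hL ⟨by linarith, by linarith⟩ : n ∈ Icc a b \ N).2 hn

/-- The centre of a gap of positive width is away from `N`, so only zero-width gaps matter here; at
a straight point the gap could be prolonged on the side where `F` leaves `[m, M]`. -/
theorem centre_iff_of_mem_closure (hF : IsFold a b A C F) (hC : C.Finite) {x : ℝ}
    (hx : x ∈ closure (crossed a b m M C F)) :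
    (∃ s t, IsMaximalIcc (Icc a b \ crossed a b m M C F) a b s t ∧ x = (s + t) / 2) ↔ x ∈ C := by
  set N := crossed a b m M C F with hN
  constructor
  · rintro ⟨s, t, ⟨has, hst, htb, hL, hmax⟩, hxst⟩
    have hxs : s = x ∧ t = x := by
      rcases hst.eq_or_lt with h | h
      · constructor <;> linarith
      · exfalso
        obtain ⟨n, hn, hd⟩ := Metric.mem_closure_iff.1 hx ((t - s) / 2) (by linarith)
        rw [Real.dist_eq, abs_lt] at hd
        exact (hL ⟨by linarith, by linarith⟩ : n ∈ Icc a b \ N).2 hn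
    obtain ⟨rfl, rfl⟩ := hxs
    by_contra hxC
    have hxN := (hL ⟨le_rfl, le_rfl⟩).2
    obtain ⟨e, he, δ, hδ, h⟩ := hF.straight_near_crossed hC hx hxN hxC
    obtain ⟨η, hη, hηδ, h1, h2⟩ : ∃ η > 0, η < δ ∧ a < t - η ∧ t + η < b := by
      refine ⟨min (δ / 2) (min ((t - a) / 2) ((b - t) / 2)), ?_, ?_, ?_, ?_⟩
      · exact lt_min (by linarith) (lt_min (by linarith) (by linarith))
      · exact (min_le_left _ _).trans_lt (by linarith)
      · linarith [(min_le_right (δ / 2) (min ((t - a) / 2) ((b - t) / 2))).trans (min_le_left _ _)]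
      · linarith [(min_le_right (δ / 2) (min ((t - a) / 2) ((b - t) / 2))).trans (min_le_right _ _)]
    have hfree : ∀ τ, 0 ≤ τ → τ ≤ η → t - e * τ ∈ Icc a b \ N := by
      intro τ h0 hτ
      have hI : t - e * τ ∈ Icc a b := by
        rcases he with rfl | rfl <;> constructor <;> linarith
      refine ⟨hI, fun hn => ?_⟩
      rcases h0.eq_or_lt with rfl | h0
      · rw [mul_zero, sub_zero] at hn; exact hxN hn
      · have hA : 0 ≤ A * τ := by
          obtain ⟨κ, hκ, -⟩ := hF.straight t ⟨has.le, htb.le⟩ hxC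
          exact mul_nonneg (hκ ▸ abs_nonneg κ) h0.le
        have h3 := hn.2.2
        rcases (h τ ⟨h0, by linarith⟩).2 hI with ⟨-, h2⟩ | ⟨-, h2⟩ <;> linarith [h3.1, h3.2]
    rcases he with rfl | rfl
    · have := (hmax (t - η) t (by linarith) le_rfl fun y hy => by
        have := hfree (t - y) (by linarith [hy.2]) (by linarith [hy.1])
        rwa [one_mul, sub_sub_cancel] at this).1
      linarith
    · have := (hmax t (t + η) le_rfl (by linarith) fun y hy => by
        have := hfree (y - t) (by linarith [hy.1]) (by linarith [hy.2])
        rwa [neg_one_mul, sub_neg_eq_add, add_sub_cancel] at this).2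
      linarith
  · intro hxC
    have hxI := hF.subset hxC
    obtain ⟨δ, hδ, h⟩ := hF.bent_near_crossed hC hxC hx
    refine ⟨x, x, ⟨hxI.1, le_rfl, hxI.2, fun y hy => ?_, fun s t hs ht hL => ⟨?_, ?_⟩⟩, by ring⟩
    · rw [le_antisymm hy.2 hy.1]
      exact ⟨Ioo_subset_Icc_self hxI, fun hn => hn.2.1 hxC⟩
    · by_contra hne
      have hlt := lt_of_le_of_ne hs hne
      obtain ⟨y, hy1, hy2⟩ := exists_between (show max (x - δ) s < x from
        max_lt (by linarith) hlt)
      rw [max_lt_iff] at hy1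
      exact (hL ⟨hy1.2.le, by linarith⟩ : y ∈ Icc a b \ N).2
        (h y hy2.ne (by rw [abs_lt]; constructor <;> linarith))
    · by_contra hne
      have hlt := lt_of_le_of_ne ht (Ne.symm hne)
      obtain ⟨y, hy1, hy2⟩ := exists_between (show x < min (x + δ) t from
        lt_min (by linarith) hlt)
      rw [lt_min_iff] at hy2
      exact (hL ⟨by linarith, hy2.2.le⟩ : y ∈ Icc a b \ N).2
        (h y hy1.ne' (by rw [abs_lt]; constructor <;> linarith))

theorem centre_iff_of_notMem_closure {N : Set ℝ} (hNo : IsOpen N) (hNI : N ⊆ Ioo a b)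
    (hne : N.Nonempty) {x : ℝ} (hx : x ∉ closure N) :
    (∃ s t, IsMaximalIcc (Icc a b \ N) a b s t ∧ x = (s + t) / 2) ↔
      x - Metric.infDist x N ∈ closure N ∧ x + Metric.infDist x N ∈ closure N := by
  have h0 : 0 < Metric.infDist x N := by
    rw [Metric.mem_closure_iff_infDist_zero hne] at hx
    exact lt_of_le_of_ne Metric.infDist_nonneg (Ne.symm hx)
  constructor
  · rintro ⟨s, t, h, hxst⟩
    obtain ⟨hs, ht⟩ := mem_closure_of_isMaximalIcc h
    have hst := h.2.1
    have hD : Metric.infDist x N = (t - s) / 2 := by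
      refine le_antisymm ?_ ((Metric.le_infDist hne).2 fun n hn => ?_)
      · have := Metric.infDist_le_dist_of_mem (x := x) hs
        rw [Metric.infDist_closure, Real.dist_eq, abs_of_nonneg (by linarith)] at this
        linarith
      · by_contra! hlt
        rw [Real.dist_eq, abs_lt] at hlt
        exact (h.2.2.2.1 ⟨by linarith, by linarith⟩).2 hn
    constructor
    · convert hs using 1; linarith
    · convert ht using 1; linarith
  · rintro ⟨hs, ht⟩
    refine ⟨_, _, isMaximalIcc_of_mem_closure hNo hNI (by linarith) hs ht fun y hy hyN => ?_,
      by ring⟩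
    have := Metric.infDist_le_dist_of_mem (x := x) hyN
    rw [Real.dist_eq] at this
    exact absurd this (not_le.2 (by rw [abs_lt]; constructor <;> linarith [hy.1, hy.2]))

/-- On `closure N` the creases are those of `F`. Off it they are the peaks of the distance to `N`,
the points with nearest points of `closure N` on both sides. -/
theorem isFold_recentre (hF : IsFold a b A C F) (hC : C.Finite) (hab : a < b) (hA : 0 < A)
    (hmM : m < M) (hne : (crossed a b m M C F).Nonempty) :
    IsFold a b A
      {x | ∃ s t, IsMaximalIcc (Icc a b \ crossed a b m M C F) a b s t ∧ x = (s + t) / 2}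
      (recentre A m M (crossed a b m M C F) F) := by
  set N := crossed a b m M C F with hN
  have hNo : IsOpen N := hF.isOpen_crossed hC
  have hNI : N ⊆ Ioo a b := fun x hx => hx.1
  have hsub : {x | ∃ s t, IsMaximalIcc (Icc a b \ N) a b s t ∧ x = (s + t) / 2} ⊆ Ioo a b := by
    rintro x ⟨s, t, ⟨has, hst, htb, -⟩, rfl⟩
    constructor <;> linarith
  have hAbs : |A| = A := abs_of_pos hA
  have slope : ∀ σ : ℝ, |σ| = 1 → |σ * A| = A := fun σ h => by rw [abs_mul, h, hAbs, one_mul]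
  refine ⟨hsub, fun x hxI hxE => ?_, fun x hxE => ?_⟩
  · by_cases hx : x ∈ closure N
    · have hxC : x ∉ C := fun h => hxE ((hF.centre_iff_of_mem_closure hC hx).2 h)
      obtain ⟨ε, hε, h⟩ := hF.recentre_near hC hmM hA hx
      obtain ⟨κ, hκ, δ, hδ, h'⟩ := hF.straight x hxI hxC
      refine ⟨κ, hκ, min ε δ, lt_min hε hδ, fun y hy hyx => ?_⟩
      obtain ⟨h1, h2⟩ := lt_min_iff.1 hyx
      rw [h y hy h1, h' y hy h2, recentre_of_mem hx]
    · obtain ⟨σ, k, hσ, -, ε, hε, h⟩ := hF.recentre_far hC hab hmM hne hxI hx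
      have hnb := mt (centre_iff_of_notMem_closure hNo hNI hne hx).2 hxE
      have h0 : 0 < Metric.infDist x N := by
        rw [Metric.mem_closure_iff_infDist_zero hne] at hx
        exact lt_of_le_of_ne Metric.infDist_nonneg (Ne.symm hx)
      have hx0 := h x hxI (by simpa using hε)
      rcases mem_closure_of_infDist (x := x) hne with hl | hr
      · obtain ⟨δ, hδ, hd⟩ := infDist_near_of_left hne h0 hl fun hr => hnb ⟨hl, hr⟩
        refine ⟨σ * A, slope σ hσ, min ε δ, lt_min hε hδ, fun y hy hyx => ?_⟩
        obtain ⟨h1, h2⟩ := lt_min_iff.1 hyx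
        rw [h y hy h1, hx0, hd y h2]
        ring
      · obtain ⟨δ, hδ, hd⟩ := infDist_near_of_right hne h0 (fun hl => hnb ⟨hl, hr⟩) hr
        refine ⟨-(σ * A), by rw [abs_neg]; exact slope σ hσ, min ε δ, lt_min hε hδ,
          fun y hy hyx => ?_⟩
        obtain ⟨h1, h2⟩ := lt_min_iff.1 hyx
        rw [h y hy h1, hx0, hd y h2]
        ring
  · have hxI := Ioo_subset_Icc_self (hsub hxE)
    by_cases hx : x ∈ closure N
    · have hxC : x ∈ C := (hF.centre_iff_of_mem_closure hC hx).1 hxE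
      obtain ⟨ε, hε, h⟩ := hF.recentre_near hC hmM hA hx
      obtain ⟨κ, hκ, δ, hδ, h'⟩ := hF.bent x hxC
      refine ⟨κ, hκ, min ε δ, lt_min hε hδ, fun y hy hyx => ?_⟩
      obtain ⟨h1, h2⟩ := lt_min_iff.1 hyx
      rw [h y hy h1, h' y hy h2, recentre_of_mem hx]
    · obtain ⟨σ, k, hσ, -, ε, hε, h⟩ := hF.recentre_far hC hab hmM hne hxI hx
      obtain ⟨hl, hr⟩ := (centre_iff_of_notMem_closure hNo hNI hne hx).1 hxE
      have h0 : 0 < Metric.infDist x N := by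
        rw [Metric.mem_closure_iff_infDist_zero hne] at hx
        exact lt_of_le_of_ne Metric.infDist_nonneg (Ne.symm hx)
      refine ⟨-(σ * A), by rw [abs_neg]; exact slope σ hσ, min ε (Metric.infDist x N),
        lt_min hε h0, fun y hy hyx => ?_⟩
      obtain ⟨h1, h2⟩ := lt_min_iff.1 hyx
      rw [h y hy h1, h x hxI (by simpa using hε), infDist_near_of_both hl hr y h2]
      ring

theorem recentre_notMem_Icc (hF : IsFold a b A C F) (hC : C.Finite) (hab : a < b) (hA : 0 < A)
    (hmM : m < M) (hne : (crossed a b m M C F).Nonempty) {x : ℝ} (hxI : x ∈ Icc a b)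
    (hx : x ∉ closure (crossed a b m M C F)) :
    recentre A m M (crossed a b m M C F) F x ∉ Icc m M := by
  obtain ⟨σ, k, -, hk, ε, hε, h⟩ := hF.recentre_far hC hab hmM hne hxI hx
  rw [h x hxI (by simpa using hε)]
  rw [Metric.mem_closure_iff_infDist_zero hne] at hx
  have := mul_pos hA (lt_of_le_of_ne Metric.infDist_nonneg (Ne.symm hx))
  rintro ⟨h1, h2⟩
  rcases hk with ⟨rfl, rfl⟩ | ⟨rfl, rfl⟩ <;> linarith

end IsFold

/-! ### Coordinates in the plane -/

theorem abs_sub_apply_le_dist (p q : Plane) (i : Fin 2) : |p i - q i| ≤ dist p q := by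
  have := PiLp.norm_apply_le (p - q) i
  rwa [← dist_eq_norm, PiLp.sub_apply, Real.norm_eq_abs] at this

theorem dist_eq_of_abs_sub_eq {p q r s : Plane} (h : ∀ i, |p i - q i| = |r i - s i|) :
    dist p q = dist r s := by
  simp only [EuclideanSpace.dist_eq, Real.dist_eq, h]

theorem dist_lt_of_abs_sub_lt {p q : Plane} {δ : ℝ} (h : ∀ i, |p i - q i| < δ) :
    dist p q < 2 * δ := by
  have hδ : 0 < δ := (abs_nonneg _).trans_lt (h 0)
  rw [EuclideanSpace.dist_eq, Fin.sum_univ_two, Real.dist_eq, Real.dist_eq,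
    Real.sqrt_lt' (by linarith)]
  have h0 := h 0
  have h1 := h 1
  nlinarith [abs_nonneg (p 0 - q 0), abs_nonneg (p 1 - q 1)]

/-- The point with one coordinate of `p` replaced. -/
noncomputable def move (p : Plane) (i : Fin 2) (x : ℝ) : Plane :=
  WithLp.toLp 2 (Function.update p i x)

@[simp] theorem move_same (p : Plane) (i : Fin 2) (x : ℝ) : move p i x i = x := by
  simp [move]

theorem move_of_ne (p : Plane) {i j : Fin 2} (x : ℝ) (h : j ≠ i) : move p i x j = p j := by
  simp [move, h]

theorem dist_move_lt (p : Plane) (i : Fin 2) {x δ : ℝ} (h : |x - p i| < δ) :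
    dist (move p i x) p < 2 * δ := by
  refine dist_lt_of_abs_sub_lt fun j => ?_
  by_cases hj : j = i
  · subst hj; rwa [move_same]
  · rw [move_of_ne p x hj, sub_self, abs_zero]
    exact (abs_nonneg _).trans_lt h

theorem exists_separation (x y : ℝ) : ∃ ε > 0, ∀ u v : ℝ, |u - x| < ε → |v - y| < ε →
    (x < y → u < v) ∧ (y < x → v < u) := by
  by_cases h : x = y
  · subst h; exact ⟨1, one_pos, fun u v _ _ => ⟨fun h => absurd h (lt_irrefl _),
      fun h => absurd h (lt_irrefl _)⟩⟩
  · refine ⟨|x - y| / 2, by have := abs_pos.2 (sub_ne_zero.2 h); linarith, fun u v hu hv => ?_⟩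
    rw [abs_lt] at hu hv
    constructor <;> intro h
    · rw [abs_of_neg (by linarith)] at hu hv; linarith
    · rw [abs_of_pos (by linarith)] at hu hv; linarith

/-! ### Slopes of fold functions -/

namespace IsFold

variable {a b A : ℝ} {C : Set ℝ} {g : ℝ → ℝ}

theorem derivWithin_eq (hab : a < b) {y κ : ℝ} (hy : y ∈ Icc a b)
    (h : ∀ᶠ z in 𝓝[Icc a b] y, g z = g y + κ * (z - y)) : derivWithin g (Icc a b) y = κ := by
  have h2 : HasDerivWithinAt (fun z => g y + κ * (z - y)) κ (Icc a b) y := by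
    simpa using (((hasDerivWithinAt_id y (Icc a b)).sub_const y).const_mul κ).const_add (g y)
  exact (h2.congr_of_eventuallyEq h (by simp)).derivWithin (uniqueDiffOn_Icc hab y hy)

/-- Expressing the slope by `derivWithin` makes it a function of the position, as the layer order
requires. -/
theorem exists_slope_straight (hg : IsFold a b A C g) (hab : a < b) {x : ℝ} (hx : x ∈ Icc a b)
    (hxC : x ∉ C) : ∃ κ, |κ| = A ∧ ∃ ε > 0, ∀ y ∈ Icc a b, |y - x| < ε →
      g y = g x + κ * (y - x) ∧ derivWithin g (Icc a b) y = κ := by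
  obtain ⟨κ, hκ, ε, hε, h⟩ := hg.straight x hx hxC
  refine ⟨κ, hκ, ε, hε, fun y hy hyx => ⟨h y hy hyx, derivWithin_eq hab hy ?_⟩⟩
  filter_upwards [self_mem_nhdsWithin,
    mem_nhdsWithin_of_mem_nhds (Metric.isOpen_ball.mem_nhds (show y ∈ Metric.ball x ε from hyx))]
    with z hz hzx
  rw [h z hz hzx, h y hy hyx]
  ring

theorem exists_slope_bent (hg : IsFold a b A C g) (hab : a < b) {x : ℝ} (hxC : x ∈ C) :
    ∃ κ, |κ| = A ∧ ∃ ε > 0, ∀ y ∈ Icc a b, |y - x| < ε → g y = g x + κ * |y - x| ∧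
      (x < y → derivWithin g (Icc a b) y = κ) ∧ (y < x → derivWithin g (Icc a b) y = -κ) := by
  obtain ⟨κ, hκ, ε, hε, h⟩ := hg.bent x hxC
  refine ⟨κ, hκ, ε, hε, fun y hy hyx => ⟨h y hy hyx, fun hxy => derivWithin_eq hab hy ?_,
    fun hxy => derivWithin_eq hab hy ?_⟩⟩
  · filter_upwards [self_mem_nhdsWithin, mem_nhdsWithin_of_mem_nhds (lt_mem_nhds hxy),
      mem_nhdsWithin_of_mem_nhds (Metric.isOpen_ball.mem_nhds (show y ∈ Metric.ball x ε from hyx))]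
      with z hz hxz hzx
    rw [h z hz hzx, h y hy hyx, abs_of_pos (sub_pos.2 hxz), abs_of_pos (sub_pos.2 hxy)]
    ring
  · filter_upwards [self_mem_nhdsWithin, mem_nhdsWithin_of_mem_nhds (gt_mem_nhds hxy),
      mem_nhdsWithin_of_mem_nhds (Metric.isOpen_ball.mem_nhds (show y ∈ Metric.ball x ε from hyx))]
      with z hz hxz hzx
    rw [h z hz hzx, h y hy hyx, abs_of_neg (sub_neg.2 hxz), abs_of_neg (sub_neg.2 hxy)]
    ring

theorem injective_near (hg : IsFold a b 1 C g) {x : ℝ} (hx : x ∈ Icc a b) (hxC : x ∉ C) :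
    ∃ ε > 0, ∀ y ∈ Icc a b, ∀ z ∈ Icc a b, |y - x| < ε → |z - x| < ε → g y = g z → y = z := by
  obtain ⟨κ, hκ, ε, hε, h⟩ := hg.straight x hx hxC
  refine ⟨ε, hε, fun y hy z hz hyx hzx e => ?_⟩
  rw [h y hy hyx, h z hz hzx] at e
  have hκ0 : κ ≠ 0 := by rintro rfl; simp at hκ
  have := mul_left_cancel₀ hκ0 (add_left_cancel e)
  linarith

theorem abs_sub_eq_near (hg : IsFold a b 1 C g) {x : ℝ} (hxC : x ∈ C) :
    ∃ ε > 0, ∀ y ∈ Icc a b, ∀ z ∈ Icc a b, |y - x| < ε → |z - x| < ε → g y = g z →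
      |y - x| = |z - x| := by
  obtain ⟨κ, hκ, ε, hε, h⟩ := hg.bent x hxC
  refine ⟨ε, hε, fun y hy z hz hyx hzx e => ?_⟩
  rw [h y hy hyx, h z hz hzx] at e
  have hκ0 : κ ≠ 0 := by rintro rfl; simp at hκ
  exact mul_left_cancel₀ hκ0 (add_left_cancel e)

end IsFold

/-! ### Products of fold functions are orthogonal foldings -/

/-- The rectangle with the given lower and upper bounds. -/
def box (a b : Fin 2 → ℝ) : Set Plane := {p | ∀ i, a i ≤ p i ∧ p i ≤ b i}

/-- The map that folds each coordinate separately. -/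
noncomputable def productMap (g : Fin 2 → ℝ → ℝ) (p : Plane) : Plane :=
  WithLp.toLp 2 fun i => g i (p i)

section Product

variable {a b : Fin 2 → ℝ} {C : Fin 2 → Set ℝ} {g : Fin 2 → ℝ → ℝ}

theorem productMap_apply (p : Plane) (i : Fin 2) : productMap g p i = g i (p i) := rfl

theorem apply_eq_of_productMap_eq {p q : Plane} (h : productMap g p = productMap g q)
    (i : Fin 2) : g i (p i) = g i (q i) := by
  rw [← productMap_apply (g := g) p, h, productMap_apply]

theorem isUncreasedAt_productMap (hg : ∀ i, IsFold (a i) (b i) 1 (C i) (g i)) {p : Plane}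
    (hp : p ∈ box a b) :
    IsUncreasedAt (box a b) (productMap g) p ↔ ∀ i, p i ∉ C i := by
  constructor
  · rintro ⟨ε, hε, h⟩ i hi
    obtain ⟨κ, -, δ, hδ, h'⟩ := (hg i).bent _ hi
    obtain ⟨η, hη, hb⟩ := Metric.isOpen_iff.1 isOpen_Ioo _ ((hg i).subset hi)
    obtain ⟨t, ht, ht'⟩ := exists_between (lt_min (half_pos hε) (lt_min hδ hη))
    rw [lt_min_iff, lt_min_iff] at ht'
    have key : ∀ x, |x - p i| = t → move p i x ∈ box a b ∩ Metric.ball p ε ∧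
        g i x = g i (p i) + κ * t := by
      intro x hx
      have hxI : x ∈ Icc (a i) (b i) :=
        Ioo_subset_Icc_self (hb (show x ∈ Metric.ball (p i) η by
          rw [Metric.mem_ball, Real.dist_eq, hx]; exact ht'.2.2))
      refine ⟨⟨fun j => ?_, ?_⟩, ?_⟩
      · by_cases hj : j = i
        · subst hj; rw [move_same]; exact hxI
        · rw [move_of_ne p x hj]; exact hp j
      · have := dist_move_lt p i (show |x - p i| < ε / 2 by rw [hx]; exact ht'.1)
        rw [Metric.mem_ball]; linarith
      · rw [h' x hxI (by rw [hx]; exact ht'.2.1), hx]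
    obtain ⟨h1, e1⟩ := key (p i + t) (by rw [add_sub_cancel_left, abs_of_pos ht])
    obtain ⟨h2, e2⟩ := key (p i - t) (by rw [sub_sub_cancel_left, abs_neg, abs_of_pos ht])
    -- Points mirrored in a crease are folded together although they are `2 * t` apart.
    have hf : productMap g (move p i (p i + t)) = productMap g (move p i (p i - t)) := by
      ext j
      rw [productMap_apply, productMap_apply]
      by_cases hj : j = i
      · subst hj; rw [move_same, move_same, e1, e2]
      · rw [move_of_ne _ _ hj, move_of_ne _ _ hj]
    have h3 := h _ h1 _ h2
    rw [hf, dist_self] at h3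
    have h4 := abs_sub_apply_le_dist (move p i (p i + t)) (move p i (p i - t)) i
    rw [← h3, move_same, move_same, abs_of_pos (by linarith)] at h4
    linarith
  · intro h
    have := fun i => (hg i).straight (p i) (hp i) (h i)
    choose κ hκ ε hε h' using this
    refine ⟨min (ε 0) (ε 1), lt_min (hε 0) (hε 1), fun q hq r hr => ?_⟩
    refine dist_eq_of_abs_sub_eq fun i => ?_
    have hlt : min (ε 0) (ε 1) ≤ ε i := by
      fin_cases i
      · exact min_le_left _ _
      · exact min_le_right _ _
    rw [productMap_apply, productMap_apply,
      h' i (q i) (hq.1 i) ((abs_sub_apply_le_dist q p i).trans_lt (hq.2.trans_le hlt)),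
      h' i (r i) (hr.1 i) ((abs_sub_apply_le_dist r p i).trans_lt (hr.2.trans_le hlt)),
      show g i (p i) + κ i * (q i - p i) - (g i (p i) + κ i * (r i - p i)) = κ i * (q i - r i) by
        ring, abs_mul, hκ, one_mul]

theorem mem_uncreased_productMap (hg : ∀ i, IsFold (a i) (b i) 1 (C i) (g i)) {p : Plane} :
    p ∈ uncreased (box a b) (productMap g) ↔ p ∈ box a b ∧ ∀ i, p i ∉ C i :=
  and_congr_right fun hp => isUncreasedAt_productMap hg hp

theorem creased_productMap (hg : ∀ i, IsFold (a i) (b i) 1 (C i) (g i)) :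
    creased (box a b) (productMap g) = {p | p ∈ box a b ∧ ∃ i, p i ∈ C i} := by
  ext p
  refine and_congr_right fun hp => ?_
  rw [isUncreasedAt_productMap hg hp]
  push Not
  rfl

/-- Creases run all the way across, so a crossing point of two of them has creased points near it in
both directions and is not simple. -/
theorem exists_of_isSimpleCreasePoint (hg : ∀ i, IsFold (a i) (b i) 1 (C i) (g i)) {c : Plane}
    (hc : IsSimpleCreasePoint (box a b) (productMap g) c) :
    c ∈ box a b ∧ ∃ i, c i ∈ C i ∧ ∀ j ≠ i, c j ∉ C j := by
  obtain ⟨hcR, i, ε, hε, h⟩ := hc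
  have hcb := interior_subset hcR
  rw [creased_productMap hg] at h
  have h2 : ∀ j ≠ i, c j ∉ C j := by
    intro j hj hjC
    obtain ⟨δ, hδ, hb⟩ := Metric.isOpen_iff.1 isOpen_interior c hcR
    obtain ⟨t, ht, ht'⟩ := exists_between (lt_min (half_pos hε) (half_pos hδ))
    rw [lt_min_iff] at ht'
    have hd := dist_move_lt c i (x := c i + t) (δ := min (ε / 2) (δ / 2))
      (by rw [add_sub_cancel_left, abs_of_pos ht, lt_min_iff]; exact ht')
    have h1 := (h (move c i (c i + t)) (by
      rw [Metric.mem_ball]; linarith [min_le_left (ε / 2) (δ / 2)])).1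
      ⟨interior_subset (hb (by rw [Metric.mem_ball]; linarith [min_le_right (ε / 2) (δ / 2)])),
        j, by rwa [move_of_ne _ _ hj]⟩
    rw [move_same] at h1
    linarith
  obtain ⟨-, k, hk⟩ := (h c (Metric.mem_ball_self hε)).2 rfl
  refine ⟨hcb, i, ?_, h2⟩
  by_cases hki : k = i
  · rwa [← hki]
  · exact absurd hk (h2 k hki)

/-- The layers are ordered by the second coordinate and then by the first coordinate, in a
direction that alternates between the layers of the second coordinate. -/
noncomputable def productBelow (a b : Fin 2 → ℝ) (g : Fin 2 → ℝ → ℝ) (p q : Plane) : Prop :=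
  p 1 < q 1 ∨ p 1 = q 1 ∧ 0 < derivWithin (g 1) (Icc (a 1) (b 1)) (p 1) * (q 0 - p 0)

/-- If `c` and `t` differ in height, the heights order `u` in the same way against `p` and `p'`.
Otherwise all three heights agree and `c 0 ≠ t 0` (a creased point is not an uncreased one), so the
first coordinate decides in the same way for both. -/
theorem productBelow_layer_crease (hab : ∀ i, a i < b i)
    (hg : ∀ i, IsFold (a i) (b i) 1 (C i) (g i)) {c t : Plane}
    (hc : IsSimpleCreasePoint (box a b) (productMap g) c)
    (ht : t ∈ uncreased (box a b) (productMap g)) :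
    ∃ ε > 0, ∀ p ∈ uncreased (box a b) (productMap g) ∩ Metric.ball c ε,
      ∀ p' ∈ uncreased (box a b) (productMap g) ∩ Metric.ball c ε,
      ∀ u ∈ uncreased (box a b) (productMap g) ∩ Metric.ball t ε,
        productMap g p = productMap g u → productMap g p' = productMap g u →
        ¬ (productBelow a b g p u ∧ productBelow a b g u p') := by
  obtain ⟨hcb, i, hiC, -⟩ := exists_of_isSimpleCreasePoint hg hc
  obtain ⟨htb, htC⟩ := (mem_uncreased_productMap hg).1 ht
  obtain ⟨ε₀, hε₀, s0⟩ := exists_separation (c 0) (t 0)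
  obtain ⟨ε₁, hε₁, s1⟩ := exists_separation (c 1) (t 1)
  obtain ⟨κ, -, ε₂, hε₂, hκ⟩ := (hg 1).exists_slope_straight (hab 1) (htb 1) (htC 1)
  obtain ⟨ε₃, hε₃, inj⟩ := (hg 1).injective_near (htb 1) (htC 1)
  refine ⟨min (min ε₀ ε₁) (min ε₂ ε₃), lt_min (lt_min hε₀ hε₁) (lt_min hε₂ hε₃), ?_⟩
  rintro p ⟨hp, hpc⟩ p' ⟨hp', hpc'⟩ u ⟨hu, hut⟩ e1 e2 ⟨b1, b2⟩
  have near : ∀ {q r : Plane}, q ∈ Metric.ball r (min (min ε₀ ε₁) (min ε₂ ε₃)) → ∀ i,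
      |q i - r i| < ε₀ ∧ |q i - r i| < ε₁ ∧ |q i - r i| < ε₂ ∧ |q i - r i| < ε₃ := by
    intro q r hq i
    have := (abs_sub_apply_le_dist q r i).trans_lt hq
    rw [lt_min_iff, lt_min_iff, lt_min_iff] at this
    tauto
  have sp := s1 _ _ (near hpc 1).2.1 (near hut 1).2.1
  have sp' := s1 _ _ (near hpc' 1).2.1 (near hut 1).2.1
  have le1 : p 1 ≤ u 1 := b1.elim le_of_lt fun h => h.1.le
  have le2 : u 1 ≤ p' 1 := b2.elim le_of_lt fun h => h.1.le
  rcases lt_trichotomy (c 1) (t 1) with h | h | h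
  · linarith [sp'.1 h]
  swap
  · linarith [sp.2 h]
  have f1 : p 1 = u 1 := inj _ (hp.1 1) _ (hu.1 1) (by rw [← h]; exact (near hpc 1).2.2.2)
    (near hut 1).2.2.2 (apply_eq_of_productMap_eq e1 1)
  have f2 : p' 1 = u 1 := inj _ (hp'.1 1) _ (hu.1 1) (by rw [← h]; exact (near hpc' 1).2.2.2)
    (near hut 1).2.2.2 (apply_eq_of_productMap_eq e2 1)
  rcases b1 with b1 | ⟨-, b1⟩
  · linarith
  rcases b2 with b2 | ⟨-, b2⟩
  · linarith
  rw [f1] at b1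
  have h0 : c 0 ≠ t 0 := by
    intro h0
    refine htC i ?_
    have : c = t := by ext j; fin_cases j; exacts [h0, h]
    rwa [← this]
  have sq := s0 _ _ (near hpc 0).1 (near hut 0).1
  have sq' := s0 _ _ (near hpc' 0).1 (near hut 0).1
  rcases lt_or_gt_of_ne h0 with h0 | h0
  · have := sq.1 h0
    have := sq'.1 h0
    nlinarith
  · have := sq.2 h0
    have := sq'.2 h0
    nlinarith

/-- Creases at different heights are separated by height. Two horizontal creases at one height do
not interleave because the order within a layer is reversed across the crease. When the common
height is not a crease, the points have equal heights and either separated first coordinates or ones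
mirrored in `c 0`. -/
theorem productBelow_crease_crease (hab : ∀ i, a i < b i)
    (hg : ∀ i, IsFold (a i) (b i) 1 (C i) (g i)) {c d : Plane}
    (hc : IsSimpleCreasePoint (box a b) (productMap g) c)
    (hd : IsSimpleCreasePoint (box a b) (productMap g) d) :
    ∃ ε > 0, ∀ p ∈ uncreased (box a b) (productMap g) ∩ Metric.ball c ε,
      ∀ p' ∈ uncreased (box a b) (productMap g) ∩ Metric.ball c ε,
      ∀ q ∈ uncreased (box a b) (productMap g) ∩ Metric.ball d ε,
      ∀ q' ∈ uncreased (box a b) (productMap g) ∩ Metric.ball d ε,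
        productMap g p = productMap g q → productMap g q = productMap g p' →
        productMap g p' = productMap g q' →
        ¬ (productBelow a b g p q ∧ productBelow a b g q p' ∧ productBelow a b g p' q') := by
  obtain ⟨hcb, i, hiC, hiC'⟩ := exists_of_isSimpleCreasePoint hg hc
  obtain ⟨hdb, k, hkC, hkC'⟩ := exists_of_isSimpleCreasePoint hg hd
  obtain ⟨ε₀, hε₀, s0⟩ := exists_separation (c 0) (d 0)
  obtain ⟨ε₁, hε₁, s1⟩ := exists_separation (c 1) (d 1)
  have near : ∀ {ε : ℝ} {q r : Plane}, q ∈ Metric.ball r (min (min ε₀ ε₁) ε) → ∀ i,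
      |q i - r i| < ε₀ ∧ |q i - r i| < ε₁ ∧ |q i - r i| < ε := by
    intro ε q r hq i
    have := (abs_sub_apply_le_dist q r i).trans_lt hq
    rw [lt_min_iff, lt_min_iff] at this
    tauto
  by_cases h1 : c 1 = d 1
  swap
  · refine ⟨min (min ε₀ ε₁) 1, lt_min (lt_min hε₀ hε₁) one_pos, ?_⟩
    rintro p ⟨hp, hpc⟩ p' ⟨hp', hpc'⟩ q ⟨hq, hqd⟩ q' ⟨hq', hqd'⟩ - - - ⟨b1, b2, b3⟩
    have le1 : p 1 ≤ q 1 := b1.elim le_of_lt fun h => h.1.le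
    have le2 : q 1 ≤ p' 1 := b2.elim le_of_lt fun h => h.1.le
    rcases lt_or_gt_of_ne h1 with h | h
    · linarith [(s1 _ _ (near hpc' 1).2.1 (near hqd 1).2.1).1 h]
    · linarith [(s1 _ _ (near hpc 1).2.1 (near hqd 1).2.1).2 h]
  by_cases hC1 : c 1 ∈ C 1
  · have i1 : i = 1 := by
      by_contra hi
      exact hiC' 1 (Ne.symm hi) hC1
    have k1 : k = 1 := by
      by_contra hi
      exact hkC' 1 (Ne.symm hi) (h1 ▸ hC1)
    subst i1 k1
    have c0 := hiC' 0 (by decide)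
    have d0 := hkC' 0 (by decide)
    obtain ⟨ε₂, hε₂, injc⟩ := (hg 0).injective_near (hcb 0) c0
    obtain ⟨ε₃, hε₃, injd⟩ := (hg 0).injective_near (hdb 0) d0
    obtain ⟨ε₄, hε₄, habs⟩ := (hg 1).abs_sub_eq_near hC1
    obtain ⟨κ, -, ε₅, hε₅, hκ⟩ := (hg 1).exists_slope_bent (hab 1) hC1
    refine ⟨min (min ε₀ ε₁) (min (min ε₂ ε₃) (min ε₄ ε₅)),
      lt_min (lt_min hε₀ hε₁) (lt_min (lt_min hε₂ hε₃) (lt_min hε₄ hε₅)), ?_⟩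
    rintro p ⟨hp, hpc⟩ p' ⟨hp', hpc'⟩ q ⟨hq, hqd⟩ q' ⟨hq', hqd'⟩ e1 e2 e3 ⟨b1, b2, b3⟩
    have near2 : ∀ {q r : Plane},
        q ∈ Metric.ball r (min (min ε₀ ε₁) (min (min ε₂ ε₃) (min ε₄ ε₅))) → ∀ i,
        |q i - r i| < ε₂ ∧ |q i - r i| < ε₃ ∧ |q i - r i| < ε₄ ∧ |q i - r i| < ε₅ := by
      intro q r hq i
      have := (near hq i).2.2
      rw [lt_min_iff, lt_min_iff, lt_min_iff] at this
      tauto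
    have fp : p 0 = p' 0 := injc _ (hp.1 0) _ (hp'.1 0) (near2 hpc 0).1 (near2 hpc' 0).1
      (apply_eq_of_productMap_eq (e1.trans e2) 0)
    have fq : q 0 = q' 0 := injd _ (hq.1 0) _ (hq'.1 0) (near2 hqd 0).2.1 (near2 hqd' 0).2.1
      (apply_eq_of_productMap_eq (e2.trans e3) 0)
    have le1 : p 1 ≤ q 1 := b1.elim le_of_lt fun h => h.1.le
    have le2 : q 1 ≤ p' 1 := b2.elim le_of_lt fun h => h.1.le
    have le3 : p' 1 ≤ q' 1 := b3.elim le_of_lt fun h => h.1.le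
    have npq : p 1 = q 1 → q 1 = p' 1 → False := by
      intro h h'
      rcases b1 with b1 | ⟨-, b1⟩
      · linarith
      rcases b2 with b2 | ⟨-, b2⟩
      · linarith
      rw [h] at b1
      rw [fp] at b1
      nlinarith
    have nqq : q 1 = p' 1 → p' 1 = q' 1 → False := by
      intro h h'
      rcases b2 with b2 | ⟨-, b2⟩
      · linarith
      rcases b3 with b3 | ⟨-, b3⟩
      · linarith
      rw [h] at b2
      rw [fq] at b2
      nlinarith
    have a1 := habs _ (hp.1 1) _ (hq.1 1) (near2 hpc 1).2.2.1
      (by rw [h1]; exact (near2 hqd 1).2.2.1) (apply_eq_of_productMap_eq e1 1)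
    have a2 := habs _ (hq.1 1) _ (hp'.1 1) (by rw [h1]; exact (near2 hqd 1).2.2.1)
      (near2 hpc' 1).2.2.1 (apply_eq_of_productMap_eq e2 1)
    have a3 := habs _ (hp'.1 1) _ (hq'.1 1) (near2 hpc' 1).2.2.1
      (by rw [h1]; exact (near2 hqd' 1).2.2.1) (apply_eq_of_productMap_eq e3 1)
    have np : p 1 - c 1 ≠ 0 := fun h =>
      ((mem_uncreased_productMap hg).1 hp).2 1 (by rwa [sub_eq_zero.1 h])
    have hh := abs_pos.2 np
    have dp := (hκ _ (hp.1 1) (near2 hpc 1).2.2.2).2.2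
    have dp' := (hκ _ (hp'.1 1) (near2 hpc' 1).2.2.2).2.1
    -- All four heights are `c 1 ± h` for one `h > 0` and increase along the chain. The one case
    -- left over has `p, q` below the crease and `p', q'` above it, where the slopes of `g 1` are
    -- opposite.
    rcases abs_cases (p 1 - c 1) with ⟨hp1, -⟩ | ⟨hp1, -⟩ <;>
    rcases abs_cases (q 1 - c 1) with ⟨hq1, -⟩ | ⟨hq1, -⟩ <;>
    rcases abs_cases (p' 1 - c 1) with ⟨hp1', -⟩ | ⟨hp1', -⟩ <;>
    rcases abs_cases (q' 1 - c 1) with ⟨hq1', -⟩ | ⟨hq1', -⟩ <;>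
    rw [hp1] at a1 hh <;> rw [hq1] at a1 a2 <;> rw [hp1'] at a2 a3 <;> rw [hq1'] at a3 <;>
    first
    | linarith
    | exact npq (by linarith) (by linarith)
    | exact nqq (by linarith) (by linarith)
    | skip
    rcases b1 with b1 | ⟨-, b1⟩
    · linarith
    rcases b3 with b3 | ⟨-, b3⟩
    · linarith
    rw [dp (by linarith), fp, fq] at b1
    rw [dp' (by linarith)] at b3
    linarith
  · have i0 : i = 0 := by
      by_contra hi
      have : i = 1 := by omega
      exact hC1 (this ▸ hiC)
    subst i0
    obtain ⟨ε₂, hε₂, inj⟩ := (hg 1).injective_near (hcb 1) hC1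
    obtain ⟨ε₃, hε₃, habs⟩ := (hg 0).abs_sub_eq_near hiC
    refine ⟨min (min ε₀ ε₁) (min ε₂ ε₃), lt_min (lt_min hε₀ hε₁) (lt_min hε₂ hε₃), ?_⟩
    rintro p ⟨hp, hpc⟩ p' ⟨hp', hpc'⟩ q ⟨hq, hqd⟩ q' ⟨hq', hqd'⟩ e1 e2 e3 ⟨b1, b2, b3⟩
    have near2 : ∀ {q r : Plane}, q ∈ Metric.ball r (min (min ε₀ ε₁) (min ε₂ ε₃)) → ∀ i,
        |q i - r i| < ε₂ ∧ |q i - r i| < ε₃ := by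
      intro q r hq i
      exact lt_min_iff.1 (near hq i).2.2
    have f1 : p 1 = q 1 := inj _ (hp.1 1) _ (hq.1 1) (near2 hpc 1).1
      (by rw [h1]; exact (near2 hqd 1).1) (apply_eq_of_productMap_eq e1 1)
    have f2 : q 1 = p' 1 := inj _ (hq.1 1) _ (hp'.1 1) (by rw [h1]; exact (near2 hqd 1).1)
      (near2 hpc' 1).1 (apply_eq_of_productMap_eq e2 1)
    rcases b1 with b1 | ⟨-, b1⟩
    · linarith
    rcases b2 with b2 | ⟨-, b2⟩
    · linarith
    rw [f1] at b1
    rcases lt_trichotomy (c 0) (d 0) with h | h | h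
    · have g1 := (s0 _ _ (near hpc 0).1 (near hqd 0).1).1 h
      have g2 := (s0 _ _ (near hpc' 0).1 (near hqd 0).1).1 h
      nlinarith
    · have a1 := habs _ (hp.1 0) _ (hq.1 0) (near2 hpc 0).2 (by rw [h]; exact (near2 hqd 0).2)
        (apply_eq_of_productMap_eq e1 0)
      have a2 := habs _ (hq.1 0) _ (hp'.1 0) (by rw [h]; exact (near2 hqd 0).2)
        (near2 hpc' 0).2 (apply_eq_of_productMap_eq e2 0)
      have n1 : q 0 ≠ p 0 := fun h => by rw [h, sub_self, mul_zero] at b1; exact lt_irrefl _ b1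
      have n2 : p' 0 ≠ q 0 := fun h => by rw [h, sub_self, mul_zero] at b2; exact lt_irrefl _ b2
      have m1 : q 0 - c 0 = -(p 0 - c 0) :=
        (abs_eq_abs.1 a1.symm).resolve_left fun h => n1 (by linarith)
      have m2 : p' 0 - c 0 = -(q 0 - c 0) :=
        (abs_eq_abs.1 a2.symm).resolve_left fun h => n2 (by linarith)
      -- Two successive reflections in `c 0` return to the start, so the second step undoes the
      -- first.
      have : p' 0 - q 0 = -(q 0 - p 0) := by linarith
      rw [this] at b2
      linarith
    · have g1 := (s0 _ _ (near hpc 0).1 (near hqd 0).1).2 h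
      have g2 := (s0 _ _ (near hpc' 0).1 (near hqd 0).1).2 h
      nlinarith

theorem isLayerOrder_productBelow (hab : ∀ i, a i < b i)
    (hg : ∀ i, IsFold (a i) (b i) 1 (C i) (g i)) :
    IsLayerOrder (box a b) (productMap g) (productBelow a b g) where
  irrefl p _ h := by
    rcases h with h | ⟨-, h⟩
    · exact lt_irrefl _ h
    · rw [sub_self, mul_zero] at h; exact lt_irrefl _ h
  trans p _ q _ r _ _ _ h1 h2 := by
    rcases h1 with h1 | ⟨e1, h1⟩ <;> rcases h2 with h2 | ⟨e2, h2⟩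
    · exact Or.inl (h1.trans h2)
    · exact Or.inl (e2 ▸ h1)
    · exact Or.inl (e1 ▸ h2)
    · refine Or.inr ⟨e1.trans e2, ?_⟩
      rw [← e1] at h2
      linarith
  total p hp q _ hpq hne := by
    rcases lt_trichotomy (p 1) (q 1) with h | h | h
    · exact Or.inl (Or.inl h)
    · obtain ⟨hpb, hpC⟩ := (mem_uncreased_productMap hg).1 hp
      obtain ⟨κ, hκ, ε, hε, hs⟩ := (hg 1).exists_slope_straight (hab 1) (hpb 1) (hpC 1)
      have hd := (hs _ (hpb 1) (by simpa using hε)).2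
      have h0 : q 0 - p 0 ≠ 0 := fun h0 => hne (by
        ext j; fin_cases j
        · exact (sub_eq_zero.1 h0).symm
        · exact h)
      have hκ0 : κ ≠ 0 := by rintro rfl; simp at hκ
      rcases lt_or_gt_of_ne (mul_ne_zero hκ0 h0) with h' | h'
      · right; right
        refine ⟨h.symm, ?_⟩
        rw [← h, hd]
        linarith
      · left; right
        exact ⟨h, by rwa [hd]⟩
    · exact Or.inr (Or.inl h)
  consistent p hp q hq hpq h := by
    obtain ⟨hpb, hpC⟩ := (mem_uncreased_productMap hg).1 hp
    obtain ⟨ε₀, hε₀, s0⟩ := exists_separation (p 0) (q 0)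
    obtain ⟨ε₁, hε₁, s1⟩ := exists_separation (p 1) (q 1)
    obtain ⟨κ, hκ, ε₂, hε₂, hs⟩ := (hg 1).exists_slope_straight (hab 1) (hpb 1) (hpC 1)
    obtain ⟨ε₃, hε₃, inj⟩ := (hg 1).injective_near (hpb 1) (hpC 1)
    refine ⟨min (min ε₀ ε₁) (min ε₂ ε₃), lt_min (lt_min hε₀ hε₁) (lt_min hε₂ hε₃), ?_⟩
    rintro p' ⟨hp', hpp⟩ q' ⟨hq', hqq⟩ e
    have near : ∀ {q r : Plane}, q ∈ Metric.ball r (min (min ε₀ ε₁) (min ε₂ ε₃)) → ∀ i,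
        |q i - r i| < ε₀ ∧ |q i - r i| < ε₁ ∧ |q i - r i| < ε₂ ∧ |q i - r i| < ε₃ := by
      intro q r hq i
      have := (abs_sub_apply_le_dist q r i).trans_lt hq
      rw [lt_min_iff, lt_min_iff, lt_min_iff] at this
      tauto
    rcases h with h | ⟨h, h'⟩
    · exact Or.inl ((s1 _ _ (near hpp 1).2.1 (near hqq 1).2.1).1 h)
    · refine Or.inr ⟨inj _ (hp'.1 1) _ (hq'.1 1) (near hpp 1).2.2.2
        (by rw [h]; exact (near hqq 1).2.2.2) (apply_eq_of_productMap_eq e 1), ?_⟩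
      rw [(hs _ (hpb 1) (by simpa using hε₂)).2] at h'
      rw [(hs _ (hp'.1 1) (near hpp 1).2.2.1).2]
      have hs0 := s0 _ _ (near hpp 0).1 (near hqq 0).1
      rcases lt_trichotomy (p 0) (q 0) with h0 | h0 | h0
      · have h2 := hs0.1 h0
        exact mul_pos (pos_of_mul_pos_left h' (by linarith)) (by linarith)
      · rw [h0, sub_self, mul_zero] at h'
        exact absurd h' (lt_irrefl _)
      · have h2 := hs0.2 h0
        have h3 : 0 < -κ := pos_of_mul_pos_left (b := p 0 - q 0) (by linarith) (by linarith)
        nlinarith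
  layer_crease c t hc ht _ _ := productBelow_layer_crease hab hg hc ht
  crease_crease c d hc hd _ := productBelow_crease_crease hab hg hc hd

theorem isOrthogonalFolding_productMap (hab : ∀ i, a i < b i) (hC : ∀ i, (C i).Finite)
    (hg : ∀ i, IsFold (a i) (b i) 1 (C i) (g i)) :
    IsOrthogonalFolding (box a b) (productMap g) := by
  refine ⟨?_, ⟨fun i => (hC i).toFinset, fun p hp => ?_⟩, _, isLayerOrder_productBelow hab hg⟩
  · refine (PiLp.continuous_toLp 2 _).comp_continuousOn (continuousOn_pi.2 fun i => ?_)
    refine (hg i).continuousOn.comp ?_ fun p hp => hp i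
    exact (PiLp.continuous_apply 2 _ i).continuousOn
  · rw [creased_productMap hg] at hp
    obtain ⟨i, hi⟩ := hp.2
    exact ⟨i, (hC i).mem_toFinset.2 hi⟩

end Product

/-! ### Orthogonal foldings split into one-dimensional fold functions -/

-- Polarization turns preservation of distances into preservation of inner products of
-- displacements. The coordinate vectors therefore go to an orthonormal basis, and the coefficients
-- of `n` in it are the required gradient.
open scoped InnerProductSpace in
theorem exists_affine_of_isUncreasedAt {R : Set Plane} {f : Plane → Plane} {p n : Plane}
    (hn : ‖n‖ = 1) (hp : p ∈ interior R) (hf : IsUncreasedAt R f p) :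
    ∃ c d : ℝ, c ^ 2 + d ^ 2 = 1 ∧ ∃ ε > 0, ∀ q, dist q p < ε →
      ⟪n, f q⟫_ℝ = ⟪n, f p⟫_ℝ + c * (q 0 - p 0) + d * (q 1 - p 1) := by
  obtain ⟨ε, hε, h⟩ := hf
  obtain ⟨η, hη, hb⟩ := Metric.isOpen_iff.1 isOpen_interior p hp
  set ρ := min ε η
  have hρ : 0 < ρ := lt_min hε hη
  have hiso : ∀ v w : Plane, ‖v‖ < ρ → ‖w‖ < ρ →
      ⟪f (p + v) - f p, f (p + w) - f p⟫_ℝ = ⟪v, w⟫_ℝ := by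
    have mem : ∀ v : Plane, ‖v‖ < ρ → p + v ∈ R ∩ Metric.ball p ε := by
      intro v hv
      refine ⟨interior_subset (hb ?_), ?_⟩
      · simpa using hv.trans_le (min_le_right _ _)
      · simpa using hv.trans_le (min_le_left _ _)
    have hd : ∀ v w : Plane, ‖v‖ < ρ → ‖w‖ < ρ → ‖f (p + v) - f (p + w)‖ = ‖v - w‖ := by
      intro v w hv hw
      rw [← dist_eq_norm, h _ (mem v hv) _ (mem w hw), dist_eq_norm, add_sub_add_left_eq_sub]
    intro v w hv hw
    have h0 : ‖(0 : Plane)‖ < ρ := by simpa using hρ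
    have e1 := hd v 0 hv h0
    have e2 := hd w 0 hw h0
    have e3 := hd v w hv hw
    simp only [add_zero, sub_zero] at e1 e2
    rw [real_inner_eq_norm_mul_self_add_norm_mul_self_sub_norm_sub_mul_self_div_two,
      real_inner_eq_norm_mul_self_add_norm_mul_self_sub_norm_sub_mul_self_div_two,
      sub_sub_sub_cancel_right, e1, e2, e3]
  have hδ : 0 < ρ / 2 := by linarith
  -- Coordinate vectors shortened to stay where `f` is isometric; `B` scales their images back to
  -- unit length.
  set e : Fin 2 → Plane := fun k => (ρ / 2) • EuclideanSpace.single k (1 : ℝ) with he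
  have hee : ∀ k, ‖e k‖ < ρ := by
    intro k
    rw [he]
    simp only [norm_smul, PiLp.norm_single, Real.norm_eq_abs, abs_of_pos hδ, abs_one]
    linarith
  set B : Fin 2 → Plane := fun k => (ρ / 2)⁻¹ • (f (p + e k) - f p) with hB
  have hBv : ∀ k v, ‖v‖ < ρ → ⟪B k, f (p + v) - f p⟫_ℝ = v k := by
    intro k v hv
    rw [hB, real_inner_smul_left, hiso _ _ (hee k) hv, he, real_inner_smul_left,
      EuclideanSpace.inner_single_left]
    field_simp
    simp
  have hon : Orthonormal ℝ B := by
    rw [orthonormal_iff_ite]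
    intro i j
    have : B j = (ρ / 2)⁻¹ • (f (p + e j) - f p) := rfl
    rw [this, real_inner_smul_right, hBv i _ (hee j)]
    by_cases hij : i = j
    · subst hij; simp [he, hρ.ne']
    · simp [he, hij]
  let bas : OrthonormalBasis (Fin 2) ℝ Plane :=
    (basisOfOrthonormalOfCardEqFinrank hon (by simp)).toOrthonormalBasis (by simpa using hon)
  have hbas : ∀ k, bas k = B k := fun k => by simp [bas]
  refine ⟨⟪n, B 0⟫_ℝ, ⟪n, B 1⟫_ℝ, ?_, ρ, hρ, fun q hq => ?_⟩
  · have := bas.sum_inner_mul_inner n n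
    rw [Fin.sum_univ_two, hbas, hbas, real_inner_self_eq_norm_sq, hn,
      real_inner_comm n (B 0), real_inner_comm n (B 1)] at this
    linarith
  · have := bas.sum_inner_mul_inner n (f q - f p)
    have hqp : ‖q - p‖ < ρ := by rwa [← dist_eq_norm]
    have h0 := hBv 0 (q - p) hqp
    have h1 := hBv 1 (q - p) hqp
    rw [add_sub_cancel] at h0 h1
    rw [Fin.sum_univ_two, hbas, hbas, h0, h1, inner_sub_right] at this
    simp only [PiLp.sub_apply] at this
    linarith

section Split

variable {a b : Fin 2 → ℝ} {X : Fin 2 → Set ℝ} {k : ℝ → ℝ → ℝ}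

/-- Local affinity makes the `y`-derivative locally constant in `x` off `X 0` (`stepA`). Integrating
in `y` makes `k x y - k x y'` locally constant in `x` off `X 0` (`stepB`), and continuity bridges
the finite set. -/
theorem rectangle_rule (hX : ∀ i, (X i).Finite)
    (hk₀ : ∀ y ∈ Icc (a 1) (b 1), ContinuousOn (fun x => k x y) (Icc (a 0) (b 0)))
    (hk₁ : ∀ x ∈ Icc (a 0) (b 0), ContinuousOn (k x) (Icc (a 1) (b 1)))
    (hl : ∀ x ∈ Ioo (a 0) (b 0), x ∉ X 0 → ∀ y ∈ Ioo (a 1) (b 1), y ∉ X 1 →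
      ∃ c d : ℝ, c ^ 2 + d ^ 2 = 1 ∧ ∃ ε > 0, ∀ x' y', |x' - x| < ε → |y' - y| < ε →
        k x' y' = k x y + c * (x' - x) + d * (y' - y)) {x x' y y' : ℝ}
    (hx : x ∈ Icc (a 0) (b 0)) (hx' : x' ∈ Icc (a 0) (b 0)) (hy : y ∈ Icc (a 1) (b 1))
    (hy' : y' ∈ Icc (a 1) (b 1)) : k x y - k x y' = k x' y - k x' y' := by
  have hder : ∀ x ∈ Ioo (a 0) (b 0), x ∉ X 0 → ∀ y ∈ Ioo (a 1) (b 1), y ∉ X 1 →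
      ∃ d, ∀ᶠ x' in 𝓝 x, HasDerivAt (k x') d y := by
    intro x hx hxX y hy hyX
    obtain ⟨c, d, -, ε, hε, h⟩ := hl x hx hxX y hy hyX
    refine ⟨d, ?_⟩
    filter_upwards [Metric.ball_mem_nhds x hε] with x' hx'
    have h2 : HasDerivAt (fun z => (k x y + c * (x' - x)) + d * (z - y)) d y := by
      simpa using (((hasDerivAt_id y).sub_const y).const_mul d).const_add (k x y + c * (x' - x))
    refine h2.congr_of_eventuallyEq ?_
    filter_upwards [Metric.ball_mem_nhds y hε] with z hz
    exact h x' z hx' hz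
  have stepA : ∀ x₁ ∈ Ioo (a 0) (b 0), ∀ x₂ ∈ Ioo (a 0) (b 0), (∀ z ∈ uIcc x₁ x₂, z ∉ X 0) →
      ∀ y ∈ Ioo (a 1) (b 1), y ∉ X 1 → deriv (k x₁) y = deriv (k x₂) y := by
    intro x₁ h₁ x₂ h₂ hgap y hy hyX
    have hd : ∀ z ∈ uIcc x₁ x₂, HasDerivAt (fun z => deriv (k z) y) 0 z := by
      intro z hz
      have hzI : z ∈ Ioo (a 0) (b 0) :=
        ordConnected_Ioo.uIcc_subset h₁ h₂ hz
      obtain ⟨d, hd⟩ := hder z hzI (hgap z hz) y hy hyX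
      exact (hasDerivAt_const z d).congr_of_eventuallyEq (hd.mono fun w hw => hw.deriv)
    exact eq_of_hasDerivAt_zero_off_finite (k := fun z => deriv (k z) y) finite_empty
      (fun z hz => (hd z hz).continuousAt.continuousWithinAt)
      (fun z hz _ => hd z (Ioo_subset_Icc_self hz)) left_mem_uIcc right_mem_uIcc
  have stepB : ∀ x₁ ∈ Ioo (a 0) (b 0), ∀ x₂ ∈ Ioo (a 0) (b 0), (∀ z ∈ uIcc x₁ x₂, z ∉ X 0) →
      ∀ y ∈ Icc (a 1) (b 1), ∀ y' ∈ Icc (a 1) (b 1), k x₁ y - k x₂ y = k x₁ y' - k x₂ y' := by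
    intro x₁ h₁ x₂ h₂ hgap y hy y' hy'
    refine eq_of_hasDerivAt_zero_off_finite (k := fun y => k x₁ y - k x₂ y) (hX 1)
      ((hk₁ _ (Ioo_subset_Icc_self h₁)).sub (hk₁ _ (Ioo_subset_Icc_self h₂)))
      (fun z hz hzX => ?_) hy hy'
    obtain ⟨d₁, hd₁⟩ := hder x₁ h₁ (hgap _ left_mem_uIcc) z hz hzX
    obtain ⟨d₂, hd₂⟩ := hder x₂ h₂ (hgap _ right_mem_uIcc) z hz hzX
    have e := stepA x₁ h₁ x₂ h₂ hgap z hz hzX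
    rw [hd₁.self_of_nhds.deriv, hd₂.self_of_nhds.deriv] at e
    have := hd₁.self_of_nhds.sub hd₂.self_of_nhds
    rw [e, sub_self] at this
    exact this
  refine eq_of_hasDerivAt_zero_off_finite (k := fun x => k x y - k x y') (hX 0)
    ((hk₀ y hy).sub (hk₀ y' hy')) (fun z hz hzX => ?_) hx hx'
  obtain ⟨δ, hδ, hg⟩ := exists_gap (hX 0) z
  refine (hasDerivAt_const z (k z y - k z y')).congr_of_eventuallyEq ?_
  filter_upwards [Metric.ball_mem_nhds z hδ, isOpen_Ioo.mem_nhds hz] with w hw hwI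
  have := stepB w hwI z hz (fun u hu huX => by
    have h1 : |u - z| < δ := by
      rw [abs_sub_comm]
      refine (abs_sub_right_of_mem_uIcc hu).trans_lt ?_
      rw [abs_sub_comm]
      exact hw
    rw [hg u huX h1] at huX
    exact hzX huX) y hy y' hy'
  linarith

theorem exists_mem_Ioo_notMem {X : Set ℝ} (hX : X.Finite) {u v : ℝ} (huv : u < v) :
    ∃ x ∈ Ioo u v, x ∉ X := by
  obtain ⟨x, hx, hxX⟩ := ((Ioo_infinite huv).sdiff hX).nonempty
  exact ⟨x, hx, hxX⟩

/-- The rectangle rule splits `k` along the lines through `(x₀, y₀)`. It also makes the `y`-slope at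
`(x, y₀)` the same for every `x` off `X 0`, and the unit gradient then fixes the absolute value of
the `x`-slope. -/
theorem exists_isFold_add (hab : ∀ i, a i < b i) (hX : ∀ i, (X i).Finite)
    (hk₀ : ∀ y ∈ Icc (a 1) (b 1), ContinuousOn (fun x => k x y) (Icc (a 0) (b 0)))
    (hk₁ : ∀ x ∈ Icc (a 0) (b 0), ContinuousOn (k x) (Icc (a 1) (b 1)))
    (hl : ∀ x ∈ Ioo (a 0) (b 0), x ∉ X 0 → ∀ y ∈ Ioo (a 1) (b 1), y ∉ X 1 →
      ∃ c d : ℝ, c ^ 2 + d ^ 2 = 1 ∧ ∃ ε > 0, ∀ x' y', |x' - x| < ε → |y' - y| < ε →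
        k x' y' = k x y + c * (x' - x) + d * (y' - y)) :
    ∃ (A : Fin 2 → ℝ) (C : Fin 2 → Set ℝ) (H : Fin 2 → ℝ → ℝ), A 0 ^ 2 + A 1 ^ 2 = 1 ∧
      (∀ i, (C i).Finite) ∧ (∀ i, IsFold (a i) (b i) (A i) (C i) (H i)) ∧
      ∀ x ∈ Icc (a 0) (b 0), ∀ y ∈ Icc (a 1) (b 1), k x y = H 0 x + H 1 y := by
  obtain ⟨x₀, hx₀, hx₀X⟩ := exists_mem_Ioo_notMem (hX 0) (hab 0)
  obtain ⟨y₀, hy₀, hy₀X⟩ := exists_mem_Ioo_notMem (hX 1) (hab 1)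
  have hx₀' := Ioo_subset_Icc_self hx₀
  have hy₀' := Ioo_subset_Icc_self hy₀
  have rect : ∀ x ∈ Icc (a 0) (b 0), ∀ y ∈ Icc (a 1) (b 1), k x y - k x y₀ = k x₀ y - k x₀ y₀ :=
    fun x hx y hy => rectangle_rule hX hk₀ hk₁ hl hx hx₀' hy hy₀'
  obtain ⟨c, d, hcd, ε, hε, h⟩ := hl x₀ hx₀ hx₀X y₀ hy₀ hy₀X
  have f0 : ∃ C, C.Finite ∧ IsFold (a 0) (b 0) |c| C fun x => k x y₀ := by
    refine exists_isFold (hab 0) (hX 0) (hk₀ y₀ hy₀') fun x hx hxX => ?_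
    obtain ⟨c', d', hcd', ε', hε', h'⟩ := hl x hx hxX y₀ hy₀ hy₀X
    obtain ⟨δ, hδ, hb⟩ := Metric.isOpen_iff.1 isOpen_Ioo y₀ hy₀
    obtain ⟨t, ht, ht'⟩ := exists_between (lt_min hδ (lt_min hε hε'))
    rw [lt_min_iff, lt_min_iff] at ht'
    have et : |y₀ + t - y₀| = t := by rw [add_sub_cancel_left, abs_of_pos ht]
    have r := rect x (Ioo_subset_Icc_self hx) (y₀ + t) (Ioo_subset_Icc_self (hb
      (show y₀ + t ∈ Metric.ball y₀ δ by rw [Metric.mem_ball, Real.dist_eq, et]; exact ht'.1)))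
    rw [h' x (y₀ + t) (by simpa using hε') (et.trans_lt ht'.2.2),
      h x₀ (y₀ + t) (by simpa using hε) (et.trans_lt ht'.2.1)] at r
    have hd : d' = d := mul_right_cancel₀ ht.ne' (by linarith)
    refine ⟨c', sq_eq_sq_iff_abs_eq_abs _ _ |>.1 (by rw [hd] at hcd'; linarith), ε', hε',
      fun z hz => ?_⟩
    rw [h' z y₀ hz (by simpa using hε')]
    ring
  have f1 : ∃ C, C.Finite ∧ IsFold (a 1) (b 1) |d| C fun y => k x₀ y - k x₀ y₀ := by
    refine exists_isFold (hab 1) (hX 1) ((hk₁ x₀ hx₀').sub continuousOn_const)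
      fun y hy hyX => ?_
    obtain ⟨c', d', hcd', ε', hε', h'⟩ := hl x₀ hx₀ hx₀X y hy hyX
    obtain ⟨δ, hδ, hb⟩ := Metric.isOpen_iff.1 isOpen_Ioo x₀ hx₀
    obtain ⟨t, ht, ht'⟩ := exists_between (lt_min hδ (lt_min hε hε'))
    rw [lt_min_iff, lt_min_iff] at ht'
    have et : |x₀ + t - x₀| = t := by rw [add_sub_cancel_left, abs_of_pos ht]
    have r := rect (x₀ + t) (Ioo_subset_Icc_self (hb
      (show x₀ + t ∈ Metric.ball x₀ δ by rw [Metric.mem_ball, Real.dist_eq, et]; exact ht'.1)))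
      y (Ioo_subset_Icc_self hy)
    rw [h' (x₀ + t) y (et.trans_lt ht'.2.2) (by simpa using hε'),
      h (x₀ + t) y₀ (et.trans_lt ht'.2.1) (by simpa using hε)] at r
    have hd : c' = c := mul_right_cancel₀ ht.ne' (by linarith)
    refine ⟨d', sq_eq_sq_iff_abs_eq_abs _ _ |>.1 (by rw [hd] at hcd'; linarith), ε', hε',
      fun z hz => ?_⟩
    rw [h' x₀ z (by simpa using hε') hz]
    ring
  obtain ⟨C₀, hC₀, hf₀⟩ := f0
  obtain ⟨C₁, hC₁, hf₁⟩ := f1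
  refine ⟨![|c|, |d|], ![C₀, C₁], ![fun x => k x y₀, fun y => k x₀ y - k x₀ y₀], by simpa using hcd,
    fun i => ?_, fun i => ?_, fun x hx y hy => ?_⟩
  · fin_cases i
    exacts [hC₀, hC₁]
  · fin_cases i
    exacts [hf₀, hf₁]
  · have := rect x hx y hy
    simp only [Matrix.cons_val_zero, Matrix.cons_val_one]
    linarith

end Split

theorem interior_box_of_mem_Ioo {a b : Fin 2 → ℝ} {p : Plane} (hp : ∀ i, p i ∈ Ioo (a i) (b i)) :
    p ∈ interior (box a b) := by
  have ho : IsOpen {p : Plane | ∀ i, p i ∈ Ioo (a i) (b i)} := by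
    simp only [ofPred_forall]
    exact isOpen_iInter_of_finite fun i => isOpen_Ioo.preimage (PiLp.continuous_apply 2 _ i)
  exact interior_maximal (fun q hq i => ⟨(hq i).1.le, (hq i).2.le⟩) ho hp

open scoped InnerProductSpace in
theorem IsOrthogonalFolding.exists_isFold_add {a b : Fin 2 → ℝ} (hab : ∀ i, a i < b i)
    {f : Plane → Plane} (hf : IsOrthogonalFolding (box a b) f) {n : Plane} (hn : ‖n‖ = 1) :
    ∃ (A : Fin 2 → ℝ) (C : Fin 2 → Set ℝ) (H : Fin 2 → ℝ → ℝ), A 0 ^ 2 + A 1 ^ 2 = 1 ∧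
      (∀ i, (C i).Finite) ∧ (∀ i, IsFold (a i) (b i) (A i) (C i) (H i)) ∧
      ∀ p ∈ box a b, ⟪n, f p⟫_ℝ = H 0 (p 0) + H 1 (p 1) := by
  obtain ⟨hcont, ⟨X, hX⟩, -⟩ := hf
  have hc : ContinuousOn (fun p => ⟪n, f p⟫_ℝ) (box a b) := continuousOn_const.inner hcont
  have hmem : ∀ x ∈ Icc (a 0) (b 0), ∀ y ∈ Icc (a 1) (b 1), (!₂[x, y] : Plane) ∈ box a b := by
    intro x hx y hy i
    fin_cases i
    exacts [hx, hy]
  obtain ⟨A, C, H, hA, hC, hH, e⟩ := OrthoFoldCut.exists_isFold_add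
    (k := fun x y => ⟪n, f !₂[x, y]⟫_ℝ) (X := fun i => X i) hab (fun i => (X i).finite_toSet)
    (fun y hy => hc.comp (Continuous.continuousOn (by fun_prop)) fun x hx => hmem x hx y hy)
    (fun x hx => hc.comp (Continuous.continuousOn (by fun_prop)) fun y hy => hmem x hx y hy)
    (fun x hx hxX y hy hyX => by
      have hI : ∀ i, (!₂[x, y] : Plane) i ∈ Ioo (a i) (b i) := by
        intro i
        fin_cases i
        exacts [hx, hy]
      have hint := interior_box_of_mem_Ioo hI
      have hunc : IsUncreasedAt (box a b) f !₂[x, y] := by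
        by_contra hcr
        obtain ⟨i, hi⟩ := hX _ ⟨interior_subset hint, hcr⟩
        fin_cases i
        exacts [hxX hi, hyX hi]
      obtain ⟨c, d, hcd, ε, hε, h⟩ := exists_affine_of_isUncreasedAt hn hint hunc
      refine ⟨c, d, hcd, ε / 2, by linarith, fun x' y' hx' hy' => ?_⟩
      have hd : dist (!₂[x', y'] : Plane) !₂[x, y] < 2 * (ε / 2) := by
        refine dist_lt_of_abs_sub_lt fun i => ?_
        fin_cases i
        exacts [hx', hy']
      exact h !₂[x', y'] (by linarith))
  refine ⟨A, C, H, hA, hC, hH, fun p hp => ?_⟩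
  rw [← e _ (hp 0) _ (hp 1)]
  congr 2
  ext i
  fin_cases i <;> rfl

/-- The point with coordinate `i` equal to `x` and the other one equal to `y`. -/
noncomputable def pt (i : Fin 2) (x y : ℝ) : Plane :=
  WithLp.toLp 2 fun k => if k = i then x else y

@[simp] theorem pt_same (i : Fin 2) (x y : ℝ) : pt i x y i = x := by
  simp [pt]

theorem pt_of_ne {i j : Fin 2} (hij : i ≠ j) (x y : ℝ) :
    pt i x y j = y := by
  simp [pt, hij.symm]

theorem forall_fin_two_of_ne {i j : Fin 2} (hij : i ≠ j) {Q : Fin 2 → Prop}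
    (hi : Q i) (hj : Q j) (k : Fin 2) : Q k := by
  have : k = i ∨ k = j := by omega
  rcases this with rfl | rfl
  exacts [hi, hj]

/-! ### Vertices and stripes -/

theorem mem_segment_iff_exists {p q r : Plane} :
    r ∈ segment ℝ p q ↔ ∃ t ∈ Icc (0 : ℝ) 1, r = p + t • (q - p) := by
  rw [segment_eq_image']
  exact ⟨fun ⟨t, ht, e⟩ => ⟨t, ht, e.symm⟩, fun ⟨t, ht, e⟩ => ⟨t, ht, e.symm⟩⟩

theorem isCompact_segment_plane (p q : Plane) : IsCompact (segment ℝ p q) := by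
  rw [segment_eq_image']
  exact isCompact_Icc.image (by fun_prop)

theorem HasSlope.sub_eq {s : Plane × Plane} {m : ℝ} (h : HasSlope s m) {p q : Plane}
    (hp : p ∈ segment ℝ s.1 s.2) (hq : q ∈ segment ℝ s.1 s.2) : q 1 - p 1 = m * (q 0 - p 0) := by
  obtain ⟨t, -, rfl⟩ := mem_segment_iff_exists.1 hp
  obtain ⟨u, -, rfl⟩ := mem_segment_iff_exists.1 hq
  simp only [PiLp.add_apply, PiLp.smul_apply, PiLp.sub_apply, smul_eq_mul]
  linear_combination (u - t) * h.2

namespace FoldCutInstance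

variable {P : FoldCutInstance}

theorem isCompact_cutSet (P : FoldCutInstance) : IsCompact P.cutSet := by
  have : P.cutSet = ⋃ s ∈ (P.cuts : Set (Plane × Plane)), segment ℝ s.1 s.2 := by
    ext p; simp [cutSet]
  rw [this]
  exact P.cuts.finite_toSet.isCompact_biUnion fun s _ => isCompact_segment_plane _ _

theorem cutSet_subset_paper (P : FoldCutInstance) : P.cutSet ⊆ P.paper := by
  rintro p ⟨s, hs, hp⟩
  exact P.cuts_subset s hs p hp

/-- The cuts missing `p` form a closed set and stay away from it; those through `p` lie on the line
of `s`, which covers both directions from `p`. -/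
theorem not_isVertex_of_same_slope {s : Plane × Plane} {m : ℝ} {p : Plane} (hs : s ∈ P.cuts)
    (hm : HasSlope s m) (hp : p ∈ segment ℝ s.1 s.2) (h1 : p ≠ s.1) (h2 : p ≠ s.2)
    (hall : ∀ s' ∈ P.cuts, p ∈ segment ℝ s'.1 s'.2 → HasSlope s' m) : ¬ P.IsVertex p := by
  rintro ⟨-, hv⟩
  have hd0 : s.2 0 - s.1 0 ≠ 0 := sub_ne_zero.2 (Ne.symm hm.1)
  have hd : s.2 - s.1 ≠ 0 := by
    intro h
    apply hd0
    rw [← PiLp.sub_apply, h, PiLp.zero_apply]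
  have hU : IsClosed (⋃ s' ∈ {s' ∈ (P.cuts : Set (Plane × Plane)) | p ∉ segment ℝ s'.1 s'.2},
      segment ℝ s'.1 s'.2) :=
    (P.cuts.finite_toSet.subset (sep_subset _ _)).isClosed_biUnion fun s' _ =>
      (isCompact_segment_plane _ _).isClosed
  obtain ⟨ε, hε, hb⟩ := Metric.isOpen_iff.1 hU.isOpen_compl p (by
    simp only [mem_compl_iff, mem_iUnion, not_exists]
    exact fun s' hs' h => hs'.2 h)
  obtain ⟨t₀, ht₀, hpt⟩ := mem_segment_iff_exists.1 hp
  have ht0 : 0 < t₀ := lt_of_le_of_ne ht₀.1 (by rintro rfl; exact h1 (by simpa using hpt))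
  have ht1 : t₀ < 1 := lt_of_le_of_ne ht₀.2 (by rintro rfl; exact h2 (by simpa using hpt))
  have hτ : 0 < min t₀ (1 - t₀) := lt_min ht0 (by linarith)
  have hnorm := norm_pos_iff.2 hd
  refine hv ⟨s.2 - s.1, hd, min ε (min t₀ (1 - t₀) * ‖s.2 - s.1‖),
    lt_min hε (mul_pos hτ hnorm), fun q hq => ?_⟩
  rw [Metric.mem_ball, lt_min_iff] at hq
  constructor
  · rintro ⟨s', hs', hqs⟩
    have hps : p ∈ segment ℝ s'.1 s'.2 := by
      by_contra hps
      exact hb hq.1 (mem_iUnion₂.2 ⟨s', ⟨hs', hps⟩, hqs⟩)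
    have e := (hall s' hs' hps).sub_eq hps hqs
    have e' := hm.2
    refine ⟨(q 0 - p 0) / (s.2 0 - s.1 0), ?_⟩
    ext k
    simp only [PiLp.add_apply, PiLp.smul_apply, PiLp.sub_apply, smul_eq_mul]
    fin_cases k
    · simp only [Fin.zero_eta]
      field_simp
      ring
    · simp only [Fin.mk_one]
      rw [e']
      field_simp
      linarith
  · rintro ⟨t, rfl⟩
    have ht : |t| < min t₀ (1 - t₀) := by
      have := hq.2
      rw [dist_eq_norm, add_sub_cancel_left, norm_smul, Real.norm_eq_abs] at this
      exact lt_of_mul_lt_mul_right this hnorm.le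
    rw [lt_min_iff, abs_lt, abs_lt] at ht
    refine ⟨s, hs, mem_segment_iff_exists.2 ⟨t₀ + t, ⟨by linarith, by linarith⟩, ?_⟩⟩
    rw [hpt, add_assoc, ← add_smul]

/-- A vertex is an endpoint of a cut or a common point of two cuts of slopes `α` and `-α`, which
meet at most once. -/
theorem finite_isVertex {α : ℝ} (hα : α ≠ 0)
    (hslope : ∀ s ∈ P.cuts, HasSlope s α ∨ HasSlope s (-α)) : {p | P.IsVertex p}.Finite := by
  have h1 : (⋃ s ∈ (P.cuts : Set (Plane × Plane)), ({s.1, s.2} : Set Plane)).Finite :=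
    P.cuts.finite_toSet.biUnion fun s _ => by simp
  have h2 : (⋃ s ∈ (P.cuts : Set (Plane × Plane)), ⋃ s' ∈ (P.cuts : Set (Plane × Plane)),
      {p | HasSlope s α ∧ HasSlope s' (-α) ∧ p ∈ segment ℝ s.1 s.2 ∧
        p ∈ segment ℝ s'.1 s'.2}).Finite := by
    refine P.cuts.finite_toSet.biUnion fun s _ => P.cuts.finite_toSet.biUnion fun s' _ =>
      Set.Subsingleton.finite ?_
    rintro p ⟨hs, hs', hp, hp'⟩ q ⟨-, -, hq, hq'⟩
    have e1 := hs.sub_eq hp hq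
    have e2 := hs'.sub_eq hp' hq'
    have e3 : q 0 - p 0 = 0 := by
      have : 2 * α * (q 0 - p 0) = 0 := by linarith
      exact (mul_eq_zero.1 this).resolve_left (by simpa using hα)
    rw [e3] at e1
    ext k
    fin_cases k
    · simpa using (sub_eq_zero.1 e3).symm
    · simp only [mul_zero] at e1
      simpa using (sub_eq_zero.1 e1).symm
  refine (h1.union h2).subset fun p hp => ?_
  by_contra hn
  rw [mem_union, not_or] at hn
  simp only [mem_iUnion, not_exists] at hn
  obtain ⟨s, hs, hps⟩ := hp.1
  have hend := hn.1 s hs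
  simp only [mem_insert_iff, mem_singleton_iff, not_or] at hend
  rcases hslope s hs with hm | hm
  · refine not_isVertex_of_same_slope hs hm hps hend.1 hend.2 (fun s' hs' hps' => ?_) hp
    exact (hslope s' hs').resolve_right fun hm' => hn.2 s hs s' hs' ⟨hm, hm', hps, hps'⟩
  · refine not_isVertex_of_same_slope hs hm hps hend.1 hend.2 (fun s' hs' hps' => ?_) hp
    exact (hslope s' hs').resolve_left fun hm' => hn.2 s' hs' s hs ⟨hm', hm, hps', hps⟩

theorem exists_allowed_near (P : FoldCutInstance) {i : Fin 2} {c : ℝ} (hc : c ∈ P.allowed i)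
    (hv : ∀ p, P.IsVertex p → p i ≠ c) :
    ∃ ε > 0, ∀ x ∈ Icc (P.lo i) (P.hi i), |x - c| < ε → x ∈ P.allowed i := by
  have hcl : IsClosed ((fun p : Plane => p i) '' P.cutSet) :=
    (P.isCompact_cutSet.image (PiLp.continuous_apply 2 _ i)).isClosed
  obtain ⟨ε, hε, hb⟩ := Metric.isOpen_iff.1 hcl.isOpen_compl c (by
    rintro ⟨p, hp, e⟩
    exact hv p (hc.2 p hp e) e)
  exact ⟨ε, hε, fun x hx hxc => ⟨hx, fun p hp e => absurd ⟨p, hp, e⟩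
    (hb (show x ∈ Metric.ball c ε from hxc))⟩⟩

/-- An allowed line without vertices misses the cut set, which is compact, so nearby positions are
allowed too and the stripe would not be maximal. -/
theorem IsStripe.exists_isVertex {i : Fin 2} {s t : ℝ} (h : P.IsStripe i s t) :
    (∃ p, P.IsVertex p ∧ p i = s) ∧ ∃ p, P.IsVertex p ∧ p i = t := by
  obtain ⟨hls, hst, hth, hL, hmax⟩ := h
  constructor
  · by_contra! hn
    obtain ⟨ε, hε, hb⟩ := P.exists_allowed_near (hL ⟨le_rfl, hst⟩) hn
    obtain ⟨s', h1, h2⟩ := exists_between (max_lt hls (show s - ε < s by linarith))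
    rw [max_lt_iff] at h1
    refine h2.ne (hmax s' t h2.le le_rfl fun x hx => ?_).1
    rcases le_or_gt s x with hsx | hsx
    · exact hL ⟨hsx, hx.2⟩
    · exact hb x ⟨by linarith [hx.1], by linarith [hx.2]⟩
        (by rw [abs_lt]; constructor <;> linarith [hx.1])
  · by_contra! hn
    obtain ⟨ε, hε, hb⟩ := P.exists_allowed_near (hL ⟨hst, le_rfl⟩) hn
    obtain ⟨t', h1, h2⟩ := exists_between (lt_min hth (show t < t + ε by linarith))
    rw [lt_min_iff] at h2
    refine h1.ne' (hmax s t' le_rfl h1.le fun x hx => ?_).2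
    rcases le_or_gt x t with hsx | hsx
    · exact hL ⟨hx.1, hsx⟩
    · exact hb x ⟨by linarith [hx.1], by linarith [hx.2]⟩
        (by rw [abs_lt]; constructor <;> linarith [hx.2])

theorem finite_canonicalCreases (hV : {p | P.IsVertex p}.Finite) (i : Fin 2) :
    (P.canonicalCreases i).Finite := by
  have hE := hV.image fun p : Plane => p i
  refine ((hE.prod hE).image fun x : ℝ × ℝ => (x.1 + x.2) / 2).subset ?_
  rintro c ⟨s, t, h, rfl⟩
  obtain ⟨⟨p, hp, rfl⟩, q, hq, rfl⟩ := h.exists_isVertex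
  exact ⟨(p i, q i), ⟨⟨p, hp, rfl⟩, q, hq, rfl⟩, rfl⟩

theorem canonicalCreases_eq_empty (h : P.cutSet = ∅) (i : Fin 2) : P.canonicalCreases i = ∅ := by
  rw [eq_empty_iff_forall_notMem]
  rintro c ⟨s, t, ⟨hls, hst, hth, -, hmax⟩, -⟩
  refine hls.ne (hmax (P.lo i) (P.hi i) hls.le hth.le fun x hx => ⟨hx, fun p hp => ?_⟩).1
  rw [h] at hp
  exact absurd hp (notMem_empty p)

/-! ### Cut sets given by an equation between two fold functions -/

section Represented

variable {i j : Fin 2} {A B : ℝ} {C D : Set ℝ} {F H : ℝ → ℝ}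

/-- Near `p` the cut set is a line in a direction with both components nonzero, as `B * |d j| = A *
|d i|`. It continues on both sides of `p`, so `p i` is interior; a crease at `p i` would add the
mirror image of the line. -/
theorem straight_of_not_isVertex (hij : i ≠ j) (hF : IsFold (P.lo i) (P.hi i) A C F)
    (hH : IsFold (P.lo j) (P.hi j) B D H) (hA : 0 < A) (hB : 0 < B)
    (hK : ∀ p, p ∈ P.cutSet ↔ p ∈ P.paper ∧ F (p i) = H (p j)) {p : Plane} (hp : p ∈ P.cutSet)
    (hv : ¬ P.IsVertex p) : p i ∈ Ioo (P.lo i) (P.hi i) ∧ p i ∉ C := by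
  have hv' : ∃ d : Plane, d ≠ 0 ∧ ∃ ε > 0, ∀ q ∈ Metric.ball p ε,
      q ∈ P.cutSet ↔ ∃ t : ℝ, q = p + t • d := by
    by_contra h
    exact hv ⟨hp, h⟩
  obtain ⟨d, hd, ε, hε, h⟩ := hv'
  have hpp := P.cutSet_subset_paper hp
  have hpK := ((hK p).1 hp).2
  obtain ⟨ε₁, hε₁, h1⟩ := hF.abs_sub_eq (hpp i)
  obtain ⟨ε₂, hε₂, h2⟩ := hH.abs_sub_eq (hpp j)
  have bentF : p i ∈ C → ∃ δ > 0, ∀ y ∈ Icc (P.lo i) (P.hi i), ∀ z ∈ Icc (P.lo i) (P.hi i),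
      |y - p i| < δ → |z - p i| = |y - p i| → F z = F y := by
    intro hC
    obtain ⟨κ, -, δ, hδ, h'⟩ := hF.bent _ hC
    exact ⟨δ, hδ, fun y hy z hz hyp e => by rw [h' y hy hyp, h' z hz (e ▸ hyp), e]⟩
  obtain ⟨ε₃, hε₃, h3⟩ : ∃ δ > 0, p i ∈ C → ∀ y ∈ Icc (P.lo i) (P.hi i),
      ∀ z ∈ Icc (P.lo i) (P.hi i), |y - p i| < δ → |z - p i| = |y - p i| → F z = F y := by
    by_cases hC : p i ∈ C
    · obtain ⟨δ, hδ, h'⟩ := bentF hC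
      exact ⟨δ, hδ, fun _ => h'⟩
    · exact ⟨1, one_pos, fun h => absurd h hC⟩
  have hnorm := norm_pos_iff.2 hd
  have hmin : 0 < min (min ε ε₁) (min ε₂ ε₃) := lt_min (lt_min hε hε₁) (lt_min hε₂ hε₃)
  obtain ⟨t, ht, ht'⟩ := exists_between (div_pos hmin hnorm)
  rw [lt_div_iff₀ hnorm, lt_min_iff, lt_min_iff, lt_min_iff] at ht'
  have hle : ∀ k, |t * d k| ≤ t * ‖d‖ := fun k => by
    rw [abs_mul, abs_of_pos ht]
    exact mul_le_mul_of_nonneg_left (by simpa using PiLp.norm_apply_le d k) ht.le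
  have hdist : ∀ s : ℝ, |s| = t → dist (p + s • d) p = t * ‖d‖ := by
    intro s hs
    rw [dist_eq_norm, add_sub_cancel_left, norm_smul, Real.norm_eq_abs, hs]
  have hmemK : ∀ s : ℝ, |s| = t → p + s • d ∈ P.cutSet := fun s hs =>
    (h _ (by rw [Metric.mem_ball, hdist s hs]; exact ht'.1.1)).2 ⟨s, rfl⟩
  have kp := hmemK t (abs_of_pos ht)
  have km := hmemK (-t) (by rw [abs_neg, abs_of_pos ht])
  have rp := P.cutSet_subset_paper kp
  have rm := P.cutSet_subset_paper km
  have ep := ((hK _).1 kp).2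
  have em := ((hK _).1 km).2
  have coord : ∀ (s : ℝ) k, (p + s • d) k = p k + s * d k := fun s k => by simp
  have hadd : ∀ k, |p k + t * d k - p k| = |t * d k| := fun k => by rw [add_sub_cancel_left]
  have rpi : p i + t * d i ∈ Icc (P.lo i) (P.hi i) := coord t i ▸ rp i
  have rpj : p j + t * d j ∈ Icc (P.lo j) (P.hi j) := coord t j ▸ rp j
  have rmi : p i + -t * d i ∈ Icc (P.lo i) (P.hi i) := coord (-t) i ▸ rm i
  have rmj : p j + -t * d j ∈ Icc (P.lo j) (P.hi j) := coord (-t) j ▸ rm j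
  rw [coord, coord] at ep em
  have hi := hle i
  have hj := hle j
  have e1 := h1 _ rpi (by rw [hadd]; linarith)
  have e2 := h2 _ rpj (by rw [hadd]; linarith)
  rw [ep, hpK, e2, hadd, hadd, abs_mul, abs_mul, abs_of_pos ht] at e1
  have e3 : B * |d j| = A * |d i| := by
    have : t * (B * |d j|) = t * (A * |d i|) := by linarith
    exact mul_left_cancel₀ ht.ne' this
  have hdi : d i ≠ 0 := by
    intro h0
    rw [h0, abs_zero, mul_zero] at e3
    have h0' := abs_eq_zero.1 ((mul_eq_zero.1 e3).resolve_left hB.ne')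
    exact hd (PiLp.ext (forall_fin_two_of_ne hij h0 h0'))
  have hdj : d j ≠ 0 := by
    intro h0
    rw [h0, abs_zero, mul_zero] at e3
    exact hdi (abs_eq_zero.1 ((mul_eq_zero.1 e3.symm).resolve_left hA.ne'))
  constructor
  · have hne : t * d i ≠ 0 := mul_ne_zero ht.ne' hdi
    rcases lt_or_gt_of_ne hne with hlt | hlt
    · constructor <;> linarith [rpi.1, rpi.2, rmi.1, rmi.2]
    · constructor <;> linarith [rpi.1, rpi.2, rmi.1, rmi.2]
  · intro hC
    have hFF := h3 hC _ rmi _ rpi (by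
      rw [add_sub_cancel_left, neg_mul, abs_neg]; linarith)
      (by rw [hadd, add_sub_cancel_left, neg_mul, abs_neg])
    -- The mirror image of `p - t • d` in the crease satisfies the equation but is not on the line.
    have hq : pt i (p i + t * d i) (p j + -t * d j) ∈ P.cutSet := by
      rw [hK, pt_same, pt_of_ne hij]
      refine ⟨forall_fin_two_of_ne hij ?_ ?_, hFF.trans em⟩
      · rw [pt_same]; exact rpi
      · rw [pt_of_ne hij]; exact rmj
    have hqd : dist (pt i (p i + t * d i) (p j + -t * d j)) p = dist (p + t • d) p := by
      refine dist_eq_of_abs_sub_eq (forall_fin_two_of_ne hij ?_ ?_)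
      · rw [pt_same, coord]
      · rw [pt_of_ne hij, coord, hadd, add_sub_cancel_left, neg_mul, abs_neg]
    obtain ⟨u, hu⟩ := (h _ (by
      rw [Metric.mem_ball, hqd, hdist t (abs_of_pos ht)]; exact ht'.1.1)).1 hq
    have u1 := congrArg (fun q : Plane => q i) hu
    have u2 := congrArg (fun q : Plane => q j) hu
    simp only [coord, pt_same, pt_of_ne hij] at u1 u2
    have v1 : t = u := mul_right_cancel₀ hdi (by linarith)
    have v2 : -t = u := mul_right_cancel₀ hdj (by linarith)
    linarith

theorem not_isVertex_of_straight (hij : i ≠ j) (hF : IsFold (P.lo i) (P.hi i) A C F)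
    (hH : IsFold (P.lo j) (P.hi j) B D H) (hA : 0 < A) (hB : 0 < B)
    (hK : ∀ p, p ∈ P.cutSet ↔ p ∈ P.paper ∧ F (p i) = H (p j)) {p : Plane} (hp : p ∈ P.cutSet)
    (hi : p i ∈ Ioo (P.lo i) (P.hi i)) (hiC : p i ∉ C) (hj : p j ∈ Ioo (P.lo j) (P.hi j))
    (hjD : p j ∉ D) : ¬ P.IsVertex p := by
  rintro ⟨-, hv⟩
  obtain ⟨κ, hκ, ε₁, hε₁, h1⟩ := hF.straight _ (Ioo_subset_Icc_self hi) hiC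
  obtain ⟨μ, hμ, ε₂, hε₂, h2⟩ := hH.straight _ (Ioo_subset_Icc_self hj) hjD
  obtain ⟨ε₃, hε₃, hb⟩ := Metric.isOpen_iff.1 isOpen_interior p
    (interior_box_of_mem_Ioo (forall_fin_two_of_ne hij hi hj))
  have hκ0 : κ ≠ 0 := by rintro rfl; simp at hκ; linarith
  have hμ0 : μ ≠ 0 := by rintro rfl; simp at hμ; linarith
  refine hv ⟨pt i μ κ, fun h0 => hμ0 ?_, min ε₁ (min ε₂ ε₃), lt_min hε₁ (lt_min hε₂ hε₃),
    fun q hq => ?_⟩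
  · rw [← pt_same i μ κ, h0, PiLp.zero_apply]
  rw [Metric.mem_ball, lt_min_iff, lt_min_iff] at hq
  have hqp : q ∈ P.paper := interior_subset (hb hq.2.2)
  have hpK := ((hK p).1 hp).2
  rw [hK q, h1 _ (hqp i) ((abs_sub_apply_le_dist q p i).trans_lt hq.1),
    h2 _ (hqp j) ((abs_sub_apply_le_dist q p j).trans_lt hq.2.1), hpK]
  constructor
  · rintro ⟨-, e⟩
    refine ⟨(q i - p i) / μ, PiLp.ext (forall_fin_two_of_ne hij ?_ ?_)⟩
    · simp only [PiLp.add_apply, PiLp.smul_apply, pt_same, smul_eq_mul]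
      field_simp
      ring
    · simp only [PiLp.add_apply, PiLp.smul_apply, pt_of_ne hij, smul_eq_mul]
      field_simp
      linarith
  · rintro ⟨t, rfl⟩
    refine ⟨hqp, ?_⟩
    simp only [PiLp.add_apply, PiLp.smul_apply, pt_same, pt_of_ne hij, smul_eq_mul]
    ring

/-- A value strictly inside the range of `H` is attained at an interior straight point, which yields
a non-vertex. Conversely, at a non-vertex `H` is straight in the interior, so its value there is not
extremal. -/
theorem allowed_eq (hij : i ≠ j) (hF : IsFold (P.lo i) (P.hi i) A C F)
    (hH : IsFold (P.lo j) (P.hi j) B D H) (hA : 0 < A) (hB : 0 < B)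
    (hK : ∀ p, p ∈ P.cutSet ↔ p ∈ P.paper ∧ F (p i) = H (p j)) {m M : ℝ}
    (hm : IsLeast (H '' Icc (P.lo j) (P.hi j)) m)
    (hM : IsGreatest (H '' Icc (P.lo j) (P.hi j)) M) :
    P.allowed i = Icc (P.lo i) (P.hi i) \ crossed (P.lo i) (P.hi i) m M C F := by
  ext c
  refine and_congr_right fun hc => ⟨fun h hcr => ?_, fun h p hp hpc => ?_⟩
  · obtain ⟨hcI, hcC, hcv⟩ := hcr
    obtain ⟨⟨y₁, hy₁, rfl⟩, -⟩ := hm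
    obtain ⟨⟨y₂, hy₂, rfl⟩, -⟩ := hM
    obtain ⟨y, hy, hyD, e⟩ := hH.exists_straight_eq hy₁ hy₂ hcv.1 hcv.2
    have hp : pt i c y ∈ P.cutSet := by
      rw [hK, pt_same, pt_of_ne hij]
      refine ⟨forall_fin_two_of_ne hij ?_ ?_, e.symm⟩
      · rw [pt_same]; exact hc
      · rw [pt_of_ne hij]; exact Ioo_subset_Icc_self hy
    refine not_isVertex_of_straight hij hF hH hA hB hK hp ?_ ?_ ?_ ?_ (h _ hp (pt_same _ _ _))
    · rwa [pt_same]
    · rwa [pt_same]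
    · rwa [pt_of_ne hij]
    · rwa [pt_of_ne hij]
  · by_contra hv
    obtain ⟨hi, hiC⟩ := straight_of_not_isVertex hij hF hH hA hB hK hp hv
    obtain ⟨hj, hjD⟩ := straight_of_not_isVertex hij.symm hH hF hB hA
      (fun p => (hK p).trans (and_congr_right fun _ => eq_comm)) hp hv
    subst hpc
    refine h ⟨hi, hiC, ?_⟩
    rw [((hK p).1 hp).2]
    obtain ⟨⟨y, hy, hlt⟩, z, hz, hgt⟩ := hH.exists_lt_gt hB hj hjD
    exact ⟨(hm.2 ⟨y, hy, rfl⟩).trans_lt hlt, hgt.trans_le (hM.2 ⟨z, hz, rfl⟩)⟩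

theorem exists_not_isVertex_near (hV : {p | P.IsVertex p}.Finite) {p : Plane}
    (hp : p ∈ P.cutSet) {ε : ℝ} (hε : 0 < ε) :
    ∃ q ∈ P.cutSet, dist q p < ε ∧ ¬ P.IsVertex q := by
  obtain ⟨s, hs, hps⟩ := hp
  obtain ⟨e, he, hes⟩ : ∃ e, e ≠ p ∧ e ∈ segment ℝ s.1 s.2 := by
    by_cases h : s.1 = p
    · exact ⟨s.2, fun h' => P.cuts_ne s hs (h.trans h'.symm), right_mem_segment ℝ _ _⟩
    · exact ⟨s.1, h, left_mem_segment ℝ _ _⟩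
  have hne : e - p ≠ 0 := sub_ne_zero.2 he
  have hnorm := norm_pos_iff.2 hne
  have hinj : Function.Injective fun t : ℝ => p + t • (e - p) := fun t u h =>
    smul_left_injective ℝ hne (add_left_cancel h)
  obtain ⟨t, ht, htV⟩ := exists_mem_Ioo_notMem (hV.preimage hinj.injOn)
    (lt_min one_pos (div_pos hε hnorm))
  have ht2 := lt_min_iff.1 ht.2
  refine ⟨p + t • (e - p), ⟨s, hs, ?_⟩, ?_, htV⟩
  · exact (convex_segment s.1 s.2).add_smul_sub_mem hps hes ⟨ht.1.le, ht2.1.le⟩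
  · rw [dist_eq_norm, add_sub_cancel_left, norm_smul, Real.norm_eq_abs, abs_of_pos ht.1]
    exact (lt_div_iff₀ hnorm).1 ht2.2

theorem exists_isFold_canonicalCreases (hV : {p | P.IsVertex p}.Finite) (hne : P.cutSet.Nonempty)
    (hij : i ≠ j) (hC : C.Finite) (hF : IsFold (P.lo i) (P.hi i) A C F)
    (hH : IsFold (P.lo j) (P.hi j) B D H) (hA : 0 < A) (hB : 0 < B)
    (hK : ∀ p, p ∈ P.cutSet ↔ p ∈ P.paper ∧ F (p i) = H (p j)) :
    ∃ G, IsFold (P.lo i) (P.hi i) A (P.canonicalCreases i) G ∧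
      ∀ p, p ∈ P.cutSet ↔ p ∈ P.paper ∧ G (p i) = H (p j) := by
  have hcpt := isCompact_Icc.image_of_continuousOn hH.continuousOn
  have hnej : (H '' Icc (P.lo j) (P.hi j)).Nonempty :=
    (nonempty_Icc.2 (P.lo_lt_hi j).le).image H
  obtain ⟨m, hm⟩ := hcpt.exists_isLeast hnej
  obtain ⟨M, hM⟩ := hcpt.exists_isGreatest hnej
  have hall := allowed_eq hij hF hH hA hB hK hm hM
  set N := crossed (P.lo i) (P.hi i) m M C F with hN
  -- Cuts are nondegenerate, so non-vertices are dense in the cut set. This excludes isolated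
  -- solutions at which a crease of `F` merely touches `m` or `M`.
  have hcl : ∀ p ∈ P.cutSet, p i ∈ closure N := by
    intro p hp
    rw [Metric.mem_closure_iff]
    intro ε hε
    obtain ⟨q, hq, hqp, hqv⟩ := exists_not_isVertex_near hV hp hε
    refine ⟨q i, ?_, ?_⟩
    · by_contra hqN
      have hqa : q i ∈ P.allowed i := by
        rw [hall]
        exact ⟨P.cutSet_subset_paper hq i, hqN⟩
      exact hqv (hqa.2 q hq rfl)
    · rw [dist_comm]
      exact (abs_sub_apply_le_dist q p i).trans_lt hqp
  have hNne : N.Nonempty := by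
    obtain ⟨p, hp⟩ := hne
    exact closure_nonempty_iff.1 ⟨_, hcl p hp⟩
  have hmM : m < M := by
    obtain ⟨x, hx⟩ := hNne
    exact hx.2.2.1.trans hx.2.2.2
  refine ⟨IsFold.recentre A m M N F, ?_, fun p => ?_⟩
  · have : P.canonicalCreases i =
        {x | ∃ s t, IsMaximalIcc (Icc (P.lo i) (P.hi i) \ N) (P.lo i) (P.hi i) s t ∧
          x = (s + t) / 2} := by
      rw [← hall]
      rfl
    rw [this]
    exact hF.isFold_recentre hC (P.lo_lt_hi i) hA hmM hNne
  · by_cases hp : p i ∈ closure N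
    · rw [IsFold.recentre_of_mem hp, hK]
    · refine ⟨fun h => absurd (hcl p h) hp, fun ⟨h, e⟩ => ?_⟩
      refine absurd ?_ (hF.recentre_notMem_Icc hC (P.lo_lt_hi i) hA hmM hNne (h i) hp)
      rw [e]
      exact ⟨hm.2 ⟨_, h j, rfl⟩, hM.2 ⟨_, h j, rfl⟩⟩

end Represented

end FoldCutInstance

/-! ### The canonical crease pattern -/

theorem IsFold.const_sub {a b A : ℝ} {C : Set ℝ} {g : ℝ → ℝ} (hg : IsFold a b A C g) (w : ℝ) :
    IsFold a b A C fun x => w - g x := by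
  refine ⟨hg.subset, fun x hx hxC => ?_, fun x hx => ?_⟩
  · obtain ⟨κ, hκ, ε, hε, h⟩ := hg.straight x hx hxC
    exact ⟨-κ, by rw [abs_neg, hκ], ε, hε, fun y hy hyx => by simp only [h y hy hyx]; ring⟩
  · obtain ⟨κ, hκ, ε, hε, h⟩ := hg.bent x hx
    exact ⟨-κ, by rw [abs_neg, hκ], ε, hε, fun y hy hyx => by simp only [h y hy hyx]; ring⟩

open scoped InnerProductSpace in
theorem exists_unit_normal {a b : Plane} (hab : a ≠ b) :
    ∃ n : Plane, ‖n‖ = 1 ∧ ∀ q, q ∈ line[ℝ, a, b] ↔ ⟪n, q⟫_ℝ = ⟪n, a⟫_ℝ := by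
  set d := b - a with hd
  have hd0 : d ≠ 0 := sub_ne_zero.2 hab.symm
  set n₀ : Plane := !₂[d 1, -d 0] with hn₀
  have hinner : ∀ q : Plane, ⟪n₀, q⟫_ℝ = d 1 * q 0 - d 0 * q 1 := by
    intro q
    rw [PiLp.inner_apply, Fin.sum_univ_two]
    simp [hn₀]
    ring
  have hn0 : n₀ ≠ 0 := by
    intro h
    apply hd0
    have h0 := congrArg (fun q : Plane => q 0) h
    have h1 := congrArg (fun q : Plane => q 1) h
    ext k
    fin_cases k
    · simpa [hn₀] using h1
    · simpa [hn₀] using h0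
  have hnorm := norm_pos_iff.2 hn0
  refine ⟨‖n₀‖⁻¹ • n₀, norm_smul_inv_norm hn0, fun q => ?_⟩
  rw [real_inner_smul_left, real_inner_smul_left, mul_right_inj' (inv_ne_zero hnorm.ne'),
    hinner, hinner, mem_affineSpan_pair_iff_exists_lineMap_eq]
  simp only [AffineMap.lineMap_apply_module']
  rw [← hd]
  constructor
  · rintro ⟨r, rfl⟩
    simp only [PiLp.add_apply, PiLp.smul_apply, smul_eq_mul]
    ring
  · intro h
    have hs : 0 < d 0 ^ 2 + d 1 ^ 2 := by
      by_contra! hle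
      apply hd0
      ext k
      fin_cases k
      · show d 0 = 0
        nlinarith [sq_nonneg (d 0), sq_nonneg (d 1)]
      · show d 1 = 0
        nlinarith [sq_nonneg (d 0), sq_nonneg (d 1)]
    refine ⟨((q 0 - a 0) * d 0 + (q 1 - a 1) * d 1) / (d 0 ^ 2 + d 1 ^ 2), ?_⟩
    ext k
    simp only [PiLp.add_apply, PiLp.smul_apply, smul_eq_mul]
    fin_cases k
    · simp only [Fin.zero_eta]
      field_simp
      linear_combination d 1 * (-h)
    · simp only [Fin.mk_one]
      field_simp
      linear_combination d 0 * h

namespace FoldCutInstance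

variable {P : FoldCutInstance}

theorem isSolution_of_isFold {A : Fin 2 → ℝ} {C : Fin 2 → Set ℝ} {G : Fin 2 → ℝ → ℝ}
    (hA : ∀ i, 0 < A i) (hC : ∀ i, (C i).Finite)
    (hG : ∀ i, IsFold (P.lo i) (P.hi i) (A i) (C i) (G i))
    (hK : ∀ p, p ∈ P.cutSet ↔ p ∈ P.paper ∧ G 0 (p 0) = G 1 (p 1)) : P.IsSolution C := by
  have hg : ∀ i, IsFold (P.lo i) (P.hi i) 1 (C i) fun x => (A i)⁻¹ * G i x := by
    intro i
    have := (hG i).comp_mul (A i)⁻¹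
    rwa [abs_of_pos (inv_pos.2 (hA i)), inv_mul_cancel₀ (hA i).ne'] at this
  refine ⟨productMap fun i x => (A i)⁻¹ * G i x,
    -- In the folded coordinates `u = G 0 / A 0` and `v = G 1 / A 1`, the equation `G 0 = G 1` reads
    -- `A 0 * u = A 1 * v`.
    isOrthogonalFolding_productMap P.lo_lt_hi hC hg, creased_productMap hg, 0, !₂[A 1, A 0], ?_,
    fun p hp => ?_⟩
  · intro h
    have := congrArg (fun q : Plane => q 0) h
    exact (hA 1).ne (by simpa using this)
  · have h0 := (hA 0).ne'
    have h1 := (hA 1).ne'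
    rw [hK, and_iff_right (show p ∈ P.paper from hp), mem_affineSpan_pair_iff_exists_lineMap_eq]
    simp only [AffineMap.lineMap_apply_module', sub_zero, add_zero]
    constructor
    · rintro ⟨r, e⟩
      have e0 := congrArg (fun q : Plane => q 0) e
      have e1 := congrArg (fun q : Plane => q 1) e
      simp only [PiLp.smul_apply, smul_eq_mul, productMap_apply, Matrix.cons_val_zero,
        Matrix.cons_val_one] at e0 e1
      field_simp at e0 e1
      linarith
    · intro e
      refine ⟨G 0 (p 0) / (A 0 * A 1), ?_⟩
      ext k
      fin_cases k
      · simp [productMap_apply]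
        field_simp
      · simp [productMap_apply, e]
        field_simp

theorem isSolution_of_cutSet_eq_empty (h : P.cutSet = ∅) :
    P.IsSolution P.canonicalCreases := by
  have hC : ∀ i, P.canonicalCreases i = ∅ := canonicalCreases_eq_empty h
  have hg : ∀ i, IsFold (P.lo i) (P.hi i) 1 (P.canonicalCreases i) fun x => x := fun i =>
    ⟨by simp [hC], fun x _ _ => ⟨1, abs_one, 1, one_pos, fun y _ _ => by ring⟩, fun x hx => by
      rw [hC] at hx; exact absurd hx (notMem_empty x)⟩
  -- The paper stays unfolded, and the line is a vertical one to the right of it.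
  refine ⟨productMap fun _ x => x,
    isOrthogonalFolding_productMap P.lo_lt_hi (fun i => by simp [hC]) hg, creased_productMap hg,
    !₂[P.hi 0 + 1, 0], !₂[P.hi 0 + 1, 1], fun he => ?_, fun p hp => ?_⟩
  · have := congrArg (fun q : Plane => q 1) he
    simp at this
  · rw [h]
    refine iff_of_false (fun hl => ?_) (notMem_empty p)
    obtain ⟨r, e⟩ := mem_affineSpan_pair_iff_exists_lineMap_eq.1 hl
    have e0 := congrArg (fun q : Plane => q 0) e
    simp only [AffineMap.lineMap_apply_module', PiLp.add_apply, PiLp.smul_apply, PiLp.sub_apply,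
      smul_eq_mul, productMap_apply, Matrix.cons_val_zero, sub_self, mul_zero, zero_add] at e0
    linarith [(hp 0).2]

theorem exists_isFold_of_solvable {α : ℝ} (hα : α ≠ 0)
    (hslope : ∀ s ∈ P.cuts, HasSlope s α ∨ HasSlope s (-α)) (hne : P.cutSet.Nonempty)
    (hP : P.Solvable) : ∃ (A : Fin 2 → ℝ) (C : Fin 2 → Set ℝ) (F : Fin 2 → ℝ → ℝ),
      (∀ i, 0 < A i) ∧ (∀ i, (C i).Finite) ∧
      (∀ i, IsFold (P.lo i) (P.hi i) (A i) (C i) (F i)) ∧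
      ∀ p, p ∈ P.cutSet ↔ p ∈ P.paper ∧ F 0 (p 0) = F 1 (p 1) := by
  obtain ⟨f, hf, a, b, hab, hcut⟩ := hP
  obtain ⟨n, hn, hline⟩ := exists_unit_normal hab
  obtain ⟨A, C, H, hA, hC, hH, hsum⟩ :=
    IsOrthogonalFolding.exists_isFold_add (a := P.lo) (b := P.hi) P.lo_lt_hi hf hn
  set w := inner ℝ n a
  have hK : ∀ p, p ∈ P.cutSet ↔ p ∈ P.paper ∧ H 0 (p 0) = w - H 1 (p 1) := by
    intro p
    constructor
    · intro hp
      have hpp := P.cutSet_subset_paper hp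
      refine ⟨hpp, ?_⟩
      have := (hline _).1 ((hcut p hpp).2 hp)
      rw [hsum p hpp] at this
      linarith
    · rintro ⟨hpp, e⟩
      rw [← hcut p hpp, hline, hsum p hpp]
      linarith
  have hA0 : ∀ i, 0 ≤ A i := by
    intro i
    obtain ⟨x, hx, hxC⟩ := exists_mem_Ioo_notMem (hC i) (P.lo_lt_hi i)
    obtain ⟨κ, hκ, -⟩ := (hH i).straight x (Ioo_subset_Icc_self hx) hxC
    exact hκ ▸ abs_nonneg κ
  -- Along a short piece of a cut, `H 0` and `H 1` change by equal amounts; these are `A 0 * |Δx|`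
  -- and `A 1 * |α| * |Δx|`.
  have hAeq : A 0 = A 1 * |α| := by
    obtain ⟨p, s, hs, -⟩ := hne
    have hcs : ∀ q ∈ segment ℝ s.1 s.2, q ∈ P.cutSet := fun q hq => ⟨s, hs, hq⟩
    have h1 := hcs _ (left_mem_segment ℝ s.1 s.2)
    have h1p := P.cutSet_subset_paper h1
    obtain ⟨ε₀, hε₀, g0⟩ := (hH 0).abs_sub_eq (h1p 0)
    obtain ⟨ε₁, hε₁, g1⟩ := (hH 1).abs_sub_eq (h1p 1)
    have hd0 : s.2 0 - s.1 0 ≠ 0 := by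
      rcases hslope s hs with h | h <;> exact sub_ne_zero.2 h.1.symm
    have hd1 : |s.2 1 - s.1 1| = |α| * |s.2 0 - s.1 0| := by
      rcases hslope s hs with h | h <;> rw [h.2, abs_mul]
      rw [abs_neg]
    have hnorm : 0 < ‖s.2 - s.1‖ := norm_pos_iff.2 (sub_ne_zero.2 (P.cuts_ne s hs).symm)
    obtain ⟨t, ht, ht'⟩ := exists_between (lt_min one_pos (div_pos (lt_min hε₀ hε₁) hnorm))
    rw [lt_min_iff, lt_div_iff₀ hnorm, lt_min_iff] at ht'
    have hq : s.1 + t • (s.2 - s.1) ∈ P.cutSet :=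
      hcs _ (mem_segment_iff_exists.2 ⟨t, ⟨ht.le, ht'.1.le⟩, rfl⟩)
    have hqp := P.cutSet_subset_paper hq
    have hco : ∀ k, (s.1 + t • (s.2 - s.1)) k - s.1 k = t * (s.2 k - s.1 k) := fun k => by simp
    have hle : ∀ k, |t * (s.2 k - s.1 k)| ≤ t * ‖s.2 - s.1‖ := fun k => by
      rw [abs_mul, abs_of_pos ht]
      exact mul_le_mul_of_nonneg_left (by simpa using PiLp.norm_apply_le (s.2 - s.1) k) ht.le
    have e0 := g0 _ (hqp 0) (by rw [hco]; linarith [hle 0])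
    have e1 := g1 _ (hqp 1) (by rw [hco]; linarith [hle 1])
    rw [((hK _).1 hq).2, ((hK _).1 h1).2, sub_sub_sub_cancel_left, abs_sub_comm, e1, hco, hco,
      abs_mul, abs_mul, hd1] at e0
    have : t * |s.2 0 - s.1 0| ≠ 0 := mul_ne_zero ht.ne' (abs_ne_zero.2 hd0)
    rw [abs_of_pos ht] at e0
    exact mul_right_cancel₀ this (by linarith)
  have hA1 : A 1 ≠ 0 := by
    intro h
    rw [h, zero_mul] at hAeq
    rw [hAeq, h] at hA
    norm_num at hA
  have hA0' : A 0 ≠ 0 := by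
    rw [hAeq]
    exact mul_ne_zero hA1 (abs_ne_zero.2 hα)
  refine ⟨A, C, ![H 0, fun y => w - H 1 y], fun i => ?_, hC, fun i => ?_, by simpa using hK⟩
  · refine lt_of_le_of_ne (hA0 i) (Ne.symm ?_)
    fin_cases i
    exacts [hA0', hA1]
  · fin_cases i
    exacts [hH 0, (hH 1).const_sub w]

theorem isSolution_canonicalCreases {α : ℝ} (hα : α ≠ 0)
    (hslope : ∀ s ∈ P.cuts, HasSlope s α ∨ HasSlope s (-α)) (hP : P.Solvable) :
    P.IsSolution P.canonicalCreases := by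
  rcases P.cutSet.eq_empty_or_nonempty with hne | hne
  · exact isSolution_of_cutSet_eq_empty hne
  have hV := finite_isVertex hα hslope
  obtain ⟨A, C, F, hA, hC, hF, hK⟩ := exists_isFold_of_solvable hα hslope hne hP
  obtain ⟨G₀, hG₀, hK₀⟩ := exists_isFold_canonicalCreases hV hne (by decide : (0 : Fin 2) ≠ 1)
    (hC 0) (hF 0) (hF 1) (hA 0) (hA 1) hK
  -- The second replacement is made against `G₀`, which represents the same cut set; the canonical
  -- creases depend on that set alone.
  obtain ⟨G₁, hG₁, hK₁⟩ := exists_isFold_canonicalCreases hV hne (by decide : (1 : Fin 2) ≠ 0)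
    (hC 1) (hF 1) hG₀ (hA 1) (hA 0)
    (fun p => (hK₀ p).trans (and_congr_right fun _ => eq_comm))
  refine isSolution_of_isFold (G := ![G₀, G₁]) hA (finite_canonicalCreases hV) (fun i => ?_)
    fun p => (hK₁ p).trans (and_congr_right fun _ => eq_comm)
  fin_cases i
  exacts [hG₀, hG₁]

end FoldCutInstance

end OrthoFoldCut

theorem mainTheorem1 (P : OrthoFoldCut.FoldCutInstance) (α : ℝ) (hα : α ≠ 0)
    (hslope : ∀ s ∈ P.cuts, OrthoFoldCut.HasSlope s α ∨ OrthoFoldCut.HasSlope s (-α)) :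
    (∀ i, (P.canonicalCreases i).Finite) ∧
      (P.Solvable ↔ P.IsSolution P.canonicalCreases) :=
  ⟨OrthoFoldCut.FoldCutInstance.finite_canonicalCreases
      (OrthoFoldCut.FoldCutInstance.finite_isVertex hα hslope),
    OrthoFoldCut.FoldCutInstance.isSolution_canonicalCreases hα hslope,
    fun ⟨f, hf, _, hcut⟩ => ⟨f, hf, hcut⟩⟩
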